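/- Let $1\le m\le n-1$ be integers, let $s\in[m,n]$ be a real number and let $t\in[0,s)$. Let $\mathcal H^t$ denote $t$-dimensional Hausdorff measure on $\mathbb R^n$, and let $E\subseteq\mathbb R^n$ be a $t$-set, that is, an $\mathcal H^t$-measurable set with $0<\mathcal H^t(E)<\infty$. Assume that $$\liminf_{r\downarrow 0}\frac{\mathcal H^t(E\cap B(x,r))}{r^t}>0\qquad\text{for }\mathcal H^t\text{-a.e. }x\in E.$$ Then there exist countably many sets $\Gamma_1,\Gamma_2,\ldots\subseteq\mathbb R^n$, each of which is the image of $[0,1]^m$ under a map $f:[0,1]^m\to\mathbb R^n$ that is Hölder continuous with exponent $m/s$ (that is, $|f(x)-f(y)|\le C|x-y|^{m/s}$ for all $x,y\in[0,1]^m$ and some finite $C$ depending on $f$), such that $$\mathcal H^t\Big(E\setminus\bigcup_i\Gamma_i\Big)=0.$$ Moreover, if $t\in[0,1)$, then there exist countably many bi-Lipschitz embeddings $f_i:[0,1]\to\mathbb R^n$ (that is, for each $i$ there is $1\le L_i<\infty$ with $L_i^{-1}|x-y|\le|f_i(x)-f_i(y)|\le L_i|x-y|$ for all $x,y\in[0,1]$)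 such that $$\mathcal H^t\Big(E\setminus\bigcup_i f_i([0,1])\Big)=0.$$ -/

import Mathlib

open MeasureTheory Set Filter Topology
open scoped NNReal ENNReal

noncomputable section

/-- `E` is a `t`-set in `ℝⁿ`: it is measurable (in the sense of Carathéodory) for the
`t`-dimensional Hausdorff measure, and its measure is positive and finite. -/
def IsTSet {n : ℕ} (t : ℝ) (E : Set (EuclideanSpace ℝ (Fin n))) : Prop :=
  (Measure.hausdorffMeasure t : Measure (EuclideanSpace ℝ (Fin n))).toOuterMeasure.IsCaratheodory E ∧
    0 < (Measure.hausdorffMeasure t : Measure (EuclideanSpace ℝ (Fin n))) E ∧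
    (Measure.hausdorffMeasure t : Measure (EuclideanSpace ℝ (Fin n))) E < ∞

/-- The lower `t`-density `liminf_{r ↓ 0} ℋᵗ(E ∩ B(x, r)) / rᵗ`, with values in `[0, ∞]`. -/
def lowerDensity {n : ℕ} (t : ℝ) (E : Set (EuclideanSpace ℝ (Fin n)))
    (x : EuclideanSpace ℝ (Fin n)) : ℝ≥0∞ :=
  liminf (fun r : ℝ =>
    (Measure.hausdorffMeasure t : Measure (EuclideanSpace ℝ (Fin n)))
      (E ∩ Metric.closedBall x r) / ENNReal.ofReal (r ^ t)) (𝓝[>] 0)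

/-- The cube `[0,1]ᵐ` in `ℝᵐ`, where `ℝᵐ` carries the Euclidean norm. -/
def unitCube (m : ℕ) : Set (EuclideanSpace ℝ (Fin m)) :=
  {x | ∀ i, x i ∈ Icc (0 : ℝ) 1}

/-- An `(m/s)`-Hölder `m`-cube in `ℝⁿ`: the image of `[0,1]ᵐ` under a Hölder continuous map
with exponent `m/s`. Only the values of `f` on the cube matter. -/
def IsHolderCube {n : ℕ} (m : ℕ) (s : ℝ) (Γ : Set (EuclideanSpace ℝ (Fin n))) : Prop :=
  ∃ (f : EuclideanSpace ℝ (Fin m) → EuclideanSpace ℝ (Fin n)) (C : ℝ≥0),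
    HolderOnWith C (Real.toNNReal ((m : ℝ) / s)) f (unitCube m) ∧ Γ = f '' unitCube m

/-- A bi-Lipschitz curve in `ℝⁿ`: the image of `[0,1]` under a bi-Lipschitz embedding. Only the
values of `f` on `[0,1]` matter. -/
def IsBiLipschitzCurve {n : ℕ} (Γ : Set (EuclideanSpace ℝ (Fin n))) : Prop :=
  ∃ (f : ℝ → EuclideanSpace ℝ (Fin n)) (L : ℝ), 1 ≤ L ∧
    (∀ x ∈ Icc (0 : ℝ) 1, ∀ y ∈ Icc (0 : ℝ) 1,
      L⁻¹ * |x - y| ≤ ‖f x - f y‖ ∧ ‖f x - f y‖ ≤ L * |x - y|) ∧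
    Γ = f '' Icc (0 : ℝ) 1

/-- `E` is countably `(ℋᵗ, m → s)` rectifiable: countably many `(m/s)`-Hölder `m`-cubes cover `E`
up to a set of `ℋᵗ` measure zero. -/
def CountablyHolderRectifiable {n : ℕ} (t : ℝ) (m : ℕ) (s : ℝ)
    (E : Set (EuclideanSpace ℝ (Fin n))) : Prop :=
  ∃ Γ : ℕ → Set (EuclideanSpace ℝ (Fin n)), (∀ i, IsHolderCube m s (Γ i)) ∧
    (Measure.hausdorffMeasure t : Measure (EuclideanSpace ℝ (Fin n))) (E \ ⋃ i, Γ i) = 0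

/-- `E` is countably `(ℋᵗ, 1)` bi-Lipschitz rectifiable: countably many bi-Lipschitz curves cover
`E` up to a set of `ℋᵗ` measure zero. -/
def CountablyBiLipschitzRectifiable {n : ℕ} (t : ℝ)
    (E : Set (EuclideanSpace ℝ (Fin n))) : Prop :=
  ∃ Γ : ℕ → Set (EuclideanSpace ℝ (Fin n)), (∀ i, IsBiLipschitzCurve (Γ i)) ∧
    (Measure.hausdorffMeasure t : Measure (EuclideanSpace ℝ (Fin n))) (E \ ⋃ i, Γ i) = 0

end

/-!
Positive lower density, and the fact that the upper density of a finite measure is finite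
`ℋᵗ`-almost everywhere, decompose `E` up to a null set into countably many pieces `A` on which
`ℋᵗ(E ∩ B(x, r))` is comparable to `r ^ t` at all small scales
(`exists_homogeneous_decomposition`). Comparing measures of balls, such a piece is homogeneous of
dimension `t`: a `δ`-separated subset of `A ∩ B(x, r)` has `O((r / δ) ^ t)` points
(`HomogeneousWith`). It remains to put a homogeneous set of small diameter inside one Hölder cube,
and inside one bi-Lipschitz curve when `t < 1`.

Hölder cubes (`HomogeneousWith.exists_isHolderCube`). An `N`-adic cube meeting `A` has `O(N ^ t)`
subcubes meeting `A`. As `t < s`, for `N` large they can be assigned to distinct separated subcubes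
of a cube of `ℝᵐ` with side ratio `N ^ (-(s / m))`. Iterating gives a map from `A` to a Cantor
subset of `[0, 1]ᵐ` whose inverse is `(m / s)`-Hölder. Its coordinates extend to `ℝᵐ` by McShane's
formula (`exists_extension_of_subadditive`).

Bi-Lipschitz curves (`HomogeneousWith.exists_isBiLipschitzCurve`). Cut `A` repeatedly along the gaps
of length about `ρ 2 ^ (-j)` of its projections to the coordinate axes, taken cyclically. As
`t < 1`, for `ρ` small this yields classes of diameter at most `2 ^ (-j)` at level `j`
(`dist_le_of_gapRel`). Ordering the classes by the coordinate that separates them gives a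
linear order on `A`, and counting the classes that precede a point, with weight `2 ^ (-j)` at level
`j`, gives a bi-Lipschitz map `h : A → ℝ` (`exists_order_coding`). Two points nearly aligned in a
coordinate direction `e` can only be separated by the coordinate `e`, so that `h` increases in this
direction. Consequently `h` extends to a Lipschitz function `G` on `ℝⁿ` increasing with
slope bounded below along `e` (`exists_lipschitz_extension_increasing`). If `ψ` is a Lipschitz
extension of `h⁻¹` to `ℝ`, the point `f u` of the line through `ψ u` in the direction `e` at which
`G = u` describes a bi-Lipschitz curve through `A`, with Lipschitz left inverse `G`
(`exists_isBiLipschitzCurve_of_coding`).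
-/

/-! ### Extension of functions -/

/-- McShane extension for a gauge `q` that is only assumed subadditive: neither symmetric nor
nonnegative. With `q = K ‖·‖ ^ α` it extends Hölder functions; with a gauge vanishing on a ray it
extends Lipschitz functions that are monotone along this ray. -/
theorem exists_extension_of_subadditive {V ι : Type*} [AddCommGroup V] [Nonempty ι] (q : V → ℝ)
    (hq0 : q 0 = 0) (hq : ∀ u v, q (u + v) ≤ q u + q v) (p : ι → V) (g : ι → ℝ)
    (hg : ∀ i j, g i - g j ≤ q (p i - p j)) :
    ∃ G : V → ℝ, (∀ i, G (p i) = g i) ∧ ∀ x y, G x - G y ≤ q (x - y) := by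
  have hbdd : ∀ x, BddBelow (range fun i => g i + q (x - p i)) := by
    intro x
    obtain ⟨i₀⟩ := ‹Nonempty ι›
    refine ⟨g i₀ - q (p i₀ - x), ?_⟩
    rintro _ ⟨i, rfl⟩
    have h1 := hg i₀ i
    have h2 := hq (p i₀ - x) (x - p i)
    rw [sub_add_sub_cancel] at h2
    dsimp only
    linarith
  refine ⟨fun x => ⨅ i, g i + q (x - p i), fun i => ?_, fun x y => ?_⟩
  · apply le_antisymm
    · simpa [hq0] using ciInf_le (hbdd (p i)) i
    · refine le_ciInf fun j => ?_
      linarith [hg i j]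
  · rw [sub_le_iff_le_add', ← sub_le_iff_le_add]
    refine le_ciInf fun i => ?_
    have h1 := ciInf_le (hbdd x) i
    have h2 := hq (x - y) (y - p i)
    rw [sub_add_sub_cancel] at h2
    linarith

/-! ### Homogeneous sets and densities -/

/-- The set `A` has Assouad dimension at most `t`, with constant `C`: a `δ`-separated finite subset
of `A` in a ball of radius `r ≥ δ` centred on `A` has at most `C (r / δ) ^ t` points. -/
def HomogeneousWith {X : Type*} [PseudoMetricSpace X] (C t : ℝ) (A : Set X) : Prop :=
  ∀ x ∈ A, ∀ r δ : ℝ, 0 < δ → δ ≤ r → ∀ F : Finset X, (∀ y ∈ F, y ∈ A) →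
    (∀ y ∈ F, dist y x ≤ r) → (∀ y ∈ F, ∀ z ∈ F, y ≠ z → δ ≤ dist y z) →
    (F.card : ℝ) ≤ C * (r / δ) ^ t

/-- If the measure of balls centred on `A` is comparable to `r ^ t` up to twice the diameter of `A`,
comparing the volumes of disjoint balls with the volume of a ball containing them bounds the size of
separated sets. -/
theorem homogeneousWith_of_measure_closedBall {X : Type*} [PseudoMetricSpace X]
    [MeasurableSpace X] [OpensMeasurableSpace X] (μ : Measure X) [IsFiniteMeasure μ]
    {A : Set X} {c C t r₀ : ℝ} (hc : 0 < c) (ht : 0 ≤ t) (hcC : c ≤ C)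
    (hdiam : ∀ x ∈ A, ∀ y ∈ A, dist x y ≤ r₀)
    (hlow : ∀ x ∈ A, ∀ r, 0 < r → r ≤ 2 * r₀ → c * r ^ t ≤ μ.real (Metric.closedBall x r))
    (hup : ∀ x ∈ A, ∀ r, 0 < r → r ≤ 2 * r₀ → μ.real (Metric.closedBall x r) ≤ C * r ^ t) :
    HomogeneousWith (C / c * 6 ^ t) t A := by
  intro x hx r δ hδ hδr F hFA hFr hFδ
  have hr : 0 < r := hδ.trans_le hδr
  have h6 : (1 : ℝ) ≤ 6 ^ t := Real.one_le_rpow (by norm_num) ht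
  have hrδ : (1 : ℝ) ≤ (r / δ) ^ t := Real.one_le_rpow ((one_le_div hδ).2 hδr) ht
  have hCc : 1 ≤ C / c := (one_le_div hc).2 hcC
  -- With two points in `F`, separation forces `δ ≤ r₀`, so all radii used below are at most `2 r₀`.
  by_cases hcard : F.card ≤ 1
  · calc (F.card : ℝ) ≤ 1 := by exact_mod_cast hcard
      _ ≤ C / c * 6 ^ t * (r / δ) ^ t :=
        one_le_mul_of_one_le_of_one_le (one_le_mul_of_one_le_of_one_le hCc h6) hrδ
  · obtain ⟨y, hy, z, hz, hyz⟩ := Finset.one_lt_card.1 (not_le.1 hcard)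
    have hδ₀ : δ ≤ r₀ := (hFδ y hy z hz hyz).trans (hdiam y (hFA y hy) z (hFA z hz))
    set r' := min r r₀ with hr'
    have hδr' : δ ≤ r' := le_min hδr hδ₀
    have hr'pos : 0 < r' := hδ.trans_le hδr'
    have hsub : (⋃ y ∈ F, Metric.closedBall y (δ / 3)) ⊆ Metric.closedBall x (2 * r') := by
      refine iUnion₂_subset fun y hy => Metric.closedBall_subset_closedBall' ?_
      have : dist y x ≤ r' := le_min (hFr y hy) (hdiam y (hFA y hy) x hx)
      linarith
    have hdisj : (F : Set X).PairwiseDisjoint fun y => Metric.closedBall y (δ / 3) := by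
      intro y hy z hz hyz
      refine Metric.closedBall_disjoint_closedBall ?_
      have := hFδ y hy z hz hyz
      linarith
    have hsum : ∑ y ∈ F, μ.real (Metric.closedBall y (δ / 3))
        ≤ μ.real (Metric.closedBall x (2 * r')) := by
      rw [← measureReal_biUnion_finset hdisj fun _ _ => Metric.isClosed_closedBall.measurableSet]
      exact measureReal_mono hsub
    have hlow' : F.card • (c * (δ / 3) ^ t) ≤ ∑ y ∈ F, μ.real (Metric.closedBall y (δ / 3)) :=
      Finset.card_nsmul_le_sum _ _ _ fun y hy => hlow y (hFA y hy) _ (by linarith) (by linarith)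
    have hup' := hup x hx (2 * r') (by linarith)
      (mul_le_mul_of_nonneg_left (min_le_right _ _) (by norm_num))
    have hmono : (2 * r') ^ t ≤ (2 * r) ^ t :=
      Real.rpow_le_rpow (by linarith) (mul_le_mul_of_nonneg_left (min_le_left _ _) (by norm_num)) ht
    have hC : 0 < C := hc.trans_le hcC
    have hfinal : (F.card : ℝ) * (c * (δ / 3) ^ t) ≤ C * (2 * r) ^ t := by
      rw [← nsmul_eq_mul]
      exact (hlow'.trans hsum).trans (hup'.trans (mul_le_mul_of_nonneg_left hmono hC.le))
    have hpos : 0 < c * (δ / 3) ^ t := mul_pos hc (Real.rpow_pos_of_pos (by linarith) _)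
    have heq : C / c * 6 ^ t * (r / δ) ^ t * (c * (δ / 3) ^ t) = C * (2 * r) ^ t := by
      have : (2 * r : ℝ) = 6 * (r / δ) * (δ / 3) := by field_simp; norm_num
      rw [this, Real.mul_rpow (by positivity) (by positivity),
        Real.mul_rpow (by positivity) (by positivity)]
      field_simp
    rw [← heq] at hfinal
    exact le_of_mul_le_mul_right hfinal hpos

/-- The points at which a finite measure has infinite upper `t`-density form an `ℋᵗ`-null set. They
are covered by the enlargements of disjoint small balls `B(x, r)` with `(q + 1) r ^ t < μ (B(x, r))`,
so their `ℋᵗ`-measure is at most a constant times `μ univ / (q + 1)`, for every `q`. -/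
theorem hausdorffMeasure_unbounded_density {X : Type*} [MetricSpace X] [MeasurableSpace X]
    [BorelSpace X] [SecondCountableTopology X] {t : ℝ} (ht : 0 ≤ t) (μ : Measure X)
    [IsFiniteMeasure μ] :
    Measure.hausdorffMeasure t {x : X | ∀ q : ℕ, ∃ r : ℝ, 0 < r ∧ r ≤ 1 / (q + 1) ∧
      (q + 1 : ℝ) * r ^ t < μ.real (Metric.closedBall x r)} = 0 := by
  set F := {x : X | ∀ q : ℕ, ∃ r : ℝ, 0 < r ∧ r ≤ 1 / (q + 1) ∧
      (q + 1 : ℝ) * r ^ t < μ.real (Metric.closedBall x r)} with hF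
  have hcov : ∀ q : ℕ, ∃ (u : Set X) (ρ : X → ℝ), u.Countable ∧ (∀ x ∈ u, 0 < ρ x ∧
      ρ x ≤ 1 / (q + 1) ∧ (q + 1 : ℝ) * ρ x ^ t < μ.real (Metric.closedBall x (ρ x))) ∧
      u.PairwiseDisjoint (fun x => Metric.closedBall x (ρ x)) ∧
      F ⊆ ⋃ x : u, Metric.closedBall (x : X) (5 * ρ x) := by
    intro q
    have : ∀ x : X, ∃ r : ℝ, x ∈ F → 0 < r ∧ r ≤ 1 / (q + 1) ∧
      (q + 1 : ℝ) * r ^ t < μ.real (Metric.closedBall x r) := fun x => by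
      by_cases hx : x ∈ F
      · obtain ⟨r, h⟩ := hx q
        exact ⟨r, fun _ => h⟩
      · exact ⟨0, fun h => absurd h hx⟩
    choose ρ hρ using this
    obtain ⟨u, huF, hdisj, hu⟩ := Vitali.exists_disjoint_subfamily_covering_enlargement_closedBall
      F id ρ (1 / (q + 1)) (fun x hx => (hρ x hx).2.1) 5 (by norm_num)
    refine ⟨u, ρ, ?_, fun x hx => hρ x (huF hx), hdisj, fun x hx => ?_⟩
    · refine hdisj.countable_of_nonempty_interior fun x hx => ⟨x, ?_⟩
      exact mem_interior_iff_mem_nhds.2 (Metric.closedBall_mem_nhds _ (hρ x (huF hx)).1)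
    · obtain ⟨y, hy, hxy⟩ := hu x hx
      exact mem_iUnion.2 ⟨⟨y, hy⟩, hxy (Metric.mem_closedBall_self (hρ x hx).1.le)⟩
  choose u ρ hu hρ hdisj hcov using hcov
  have : ∀ q, Countable (u q) := fun q => (hu q).to_subtype
  have hlim : Tendsto (fun q : ℕ => (1 / ((q : ℝ) + 1))) atTop (𝓝 0) :=
    tendsto_one_div_add_atTop_nhds_zero_nat
  have hdiam : ∀ q (x : u q), Metric.ediam (Metric.closedBall (x : X) (5 * ρ q x))
      ≤ ENNReal.ofReal (10 * ρ q x) := by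
    intro q x
    have h0 := (hρ q x x.2).1
    have : (10 * ρ q x) = 2 * (5 * ρ q x) := by ring
    rw [this, ENNReal.ofReal_mul (by norm_num), ENNReal.ofReal_ofNat, ← Metric.closedEBall_ofReal (by linarith)]
    exact Metric.ediam_closedEBall_le
  have key := Measure.hausdorffMeasure_le_liminf_tsum t F (l := atTop)
    (fun q : ℕ => ENNReal.ofReal (10 * (1 / ((q : ℝ) + 1))))
    (by simpa using ENNReal.tendsto_ofReal (hlim.const_mul 10))
    (fun q (x : u q) => Metric.closedBall (x : X) (5 * ρ q x))
    (Eventually.of_forall fun q x => (hdiam q x).trans (ENNReal.ofReal_le_ofReal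
      (mul_le_mul_of_nonneg_left (hρ q x x.2).2.1 (by norm_num))))
    (Eventually.of_forall hcov)
  have hbound : ∀ q : ℕ, ∑' x : u q, Metric.ediam (Metric.closedBall (x : X) (5 * ρ q x)) ^ t
      ≤ ENNReal.ofReal (10 ^ t * (1 / ((q : ℝ) + 1))) * μ univ := by
    intro q
    have h1 : ∀ x : u q, Metric.ediam (Metric.closedBall (x : X) (5 * ρ q x)) ^ t ≤
        ENNReal.ofReal (10 ^ t * (1 / ((q : ℝ) + 1))) * μ (Metric.closedBall (x : X) (ρ q x)) := by
      intro x
      obtain ⟨h0, -, h2⟩ := hρ q x x.2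
      refine (ENNReal.rpow_le_rpow (hdiam q x) ht).trans ?_
      rw [ENNReal.ofReal_rpow_of_pos (by linarith), ← ofReal_measureReal (by finiteness),
        ← ENNReal.ofReal_mul (by positivity), Real.mul_rpow (by norm_num) h0.le]
      refine ENNReal.ofReal_le_ofReal ?_
      rw [mul_assoc]
      refine mul_le_mul_of_nonneg_left ?_ (by positivity)
      rw [one_div_mul_eq_div, le_div_iff₀ (by positivity)]
      linarith
    refine (ENNReal.tsum_le_tsum h1).trans ?_
    rw [ENNReal.tsum_mul_left]
    gcongr
    rw [← measure_biUnion (hu q) (hdisj q) fun _ _ => Metric.isClosed_closedBall.measurableSet]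
    exact measure_mono (subset_univ _)
  have hzero : Tendsto (fun q : ℕ => ENNReal.ofReal (10 ^ t * (1 / ((q : ℝ) + 1))) * μ univ)
      atTop (𝓝 0) := by
    have := ENNReal.Tendsto.mul_const (ENNReal.tendsto_ofReal (hlim.const_mul (10 ^ t)))
      (b := μ univ) (Or.inr (by finiteness))
    simpa using this
  refine le_antisymm (key.trans ?_) bot_le
  rw [← hzero.liminf_eq]
  exact liminf_le_liminf (Eventually.of_forall hbound)

/-- Positive lower density, together with the finiteness of the upper density almost everywhere,
decomposes `E` up to a null set into countably many homogeneous sets of small diameter. -/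
theorem exists_homogeneous_decomposition {n : ℕ} {t : ℝ} (ht : 0 ≤ t)
    {E : Set (EuclideanSpace ℝ (Fin n))}
    (hE : (Measure.hausdorffMeasure t : Measure (EuclideanSpace ℝ (Fin n))) E < ∞)
    (hdens : ∀ᵐ x ∂(Measure.hausdorffMeasure t : Measure (EuclideanSpace ℝ (Fin n))),
      x ∈ E → 0 < lowerDensity t E x) {ε : ℝ} (hε : 0 < ε) :
    ∃ (A : ℕ → Set (EuclideanSpace ℝ (Fin n))) (C : ℕ → ℝ),
      (∀ i, HomogeneousWith (C i) t (A i)) ∧ (∀ i, ∀ x ∈ A i, ∀ y ∈ A i, dist x y ≤ ε) ∧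
      (Measure.hausdorffMeasure t : Measure (EuclideanSpace ℝ (Fin n))) (E \ ⋃ i, A i) = 0 := by
  set H : Measure (EuclideanSpace ℝ (Fin n)) := Measure.hausdorffMeasure t with hH
  set μ := H.restrict E with hμ
  have : IsFiniteMeasure μ := isFiniteMeasure_restrict.2 hE.ne
  have hμball : ∀ x r, μ (Metric.closedBall x r) = H (E ∩ Metric.closedBall x r) := fun x r => by
    rw [hμ, Measure.restrict_apply Metric.isClosed_closedBall.measurableSet, inter_comm]
  set S : ℕ → Set (EuclideanSpace ℝ (Fin n)) := fun q => {x | ∀ r : ℝ, 0 < r → r ≤ 1 / (q + 1) →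
    1 / (q + 1) * r ^ t ≤ μ.real (Metric.closedBall x r) ∧
      μ.real (Metric.closedBall x r) ≤ (q + 1) * r ^ t} with hS
  set η : ℕ → ℝ := fun q => min ε (1 / (2 * ((q : ℝ) + 1))) with hη
  have hηpos : ∀ q, 0 < η q := fun q => lt_min hε (by positivity)
  set d := TopologicalSpace.denseSeq (EuclideanSpace ℝ (Fin n)) with hd
  set A : ℕ → Set (EuclideanSpace ℝ (Fin n)) := fun i =>
    S i.unpair.1 ∩ Metric.ball (d i.unpair.2) (η i.unpair.1 / 2) with hA
  have hdist : ∀ i, ∀ x ∈ A i, ∀ y ∈ A i, dist x y ≤ η i.unpair.1 := by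
    intro i x hx y hy
    have h1 := Metric.mem_ball.1 hx.2
    have h2 := Metric.mem_ball'.1 hy.2
    linarith [dist_triangle x (d i.unpair.2) y]
  refine ⟨A, fun i => (i.unpair.1 + 1) / (1 / (i.unpair.1 + 1)) * 6 ^ t, fun i => ?_,
    fun i x hx y hy => (hdist i x hx y hy).trans (min_le_left _ _), ?_⟩
  · have hq : (0 : ℝ) < (i.unpair.1 : ℝ) + 1 := by positivity
    have h2η : 2 * η i.unpair.1 ≤ 1 / ((i.unpair.1 : ℝ) + 1) := by
      calc 2 * η i.unpair.1 ≤ 2 * (1 / (2 * ((i.unpair.1 : ℝ) + 1))) :=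
            mul_le_mul_of_nonneg_left (min_le_right _ _) (by norm_num)
        _ = _ := by field_simp
    refine homogeneousWith_of_measure_closedBall μ (r₀ := η i.unpair.1) (by positivity) ht ?_
      (hdist i) (fun x hx r h0 hr => (hx.1 r h0 (hr.trans h2η)).1)
      (fun x hx r h0 hr => (hx.1 r h0 (hr.trans h2η)).2)
    rw [div_le_iff₀ hq]
    nlinarith
  · have hup : ∀ᵐ x ∂H, ∃ q : ℕ, ∀ r : ℝ, 0 < r → r ≤ 1 / (q + 1) →
        μ.real (Metric.closedBall x r) ≤ (q + 1) * r ^ t := by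
      rw [ae_iff]
      convert hausdorffMeasure_unbounded_density (X := EuclideanSpace ℝ (Fin n)) ht μ using 3
      push Not
      rfl
    refine measure_mono_null ?_ (ae_iff.1 (hdens.and hup))
    rintro x ⟨hxE, hxA⟩ ⟨hlow, q₁, hq₁⟩
    obtain ⟨c, hc0, hc⟩ := exists_between (hlow hxE)
    have hev := (eventually_lt_of_lt_liminf hc).and self_mem_nhdsWithin
    obtain ⟨r₁, hr₁, hsub⟩ := mem_nhdsGT_iff_exists_Ioc_subset.1 hev
    have hctop : c ≠ ∞ := ne_top_of_lt hc
    have hcpos : 0 < c.toReal := ENNReal.toReal_pos hc0.ne' hctop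
    obtain ⟨q₂, hq₂⟩ := exists_nat_one_div_lt (lt_min hcpos hr₁)
    refine hxA ?_
    have hmem : x ∈ S (max q₁ q₂) := by
      intro r h0 hr
      have hle : ∀ q ≤ max q₁ q₂, (1 : ℝ) / ((max q₁ q₂ : ℕ) + 1) ≤ 1 / (q + 1) := fun q hq =>
        one_div_le_one_div_of_le (by positivity) (by exact_mod_cast Nat.succ_le_succ hq)
      have hrt : 0 < r ^ t := Real.rpow_pos_of_pos h0 t
      constructor
      · have h1 : r ≤ r₁ := (hr.trans (hle _ (le_max_right _ _))).trans
          (hq₂.le.trans (min_le_right _ _))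
        have h2 := (hsub ⟨h0, h1⟩).1
        rw [← hH, ← hμball, ENNReal.lt_div_iff_mul_lt (Or.inl (by simpa using hrt))
          (Or.inl ENNReal.ofReal_ne_top)] at h2
        have h3 := ENNReal.toReal_mono (by finiteness) h2.le
        rw [ENNReal.toReal_mul, ENNReal.toReal_ofReal hrt.le] at h3
        refine le_trans ?_ h3
        exact mul_le_mul_of_nonneg_right ((hle _ (le_max_right _ _)).trans
          (hq₂.le.trans (min_le_left _ _))) hrt.le
      · refine (hq₁ r h0 (hr.trans (hle _ (le_max_left _ _)))).trans ?_
        refine mul_le_mul_of_nonneg_right ?_ hrt.le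
        exact_mod_cast Nat.succ_le_succ (le_max_left _ _)
    obtain ⟨k, hk⟩ := Metric.denseRange_iff.1
      (TopologicalSpace.denseRange_denseSeq (EuclideanSpace ℝ (Fin n))) x _
      (half_pos (hηpos (max q₁ q₂)))
    refine mem_iUnion.2 ⟨Nat.pair (max q₁ q₂) k, ?_⟩
    simp only [hA, Nat.unpair_pair]
    exact ⟨hmem, hk⟩

/-! ### Norms on Euclidean space -/

theorem EuclideanSpace.abs_apply_le_norm {n : ℕ} (v : EuclideanSpace ℝ (Fin n)) (i : Fin n) :
    |v i| ≤ ‖v‖ := by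
  simpa using PiLp.norm_apply_le v i

theorem EuclideanSpace.norm_le_sum_abs {n : ℕ} (v : EuclideanSpace ℝ (Fin n)) :
    ‖v‖ ≤ ∑ i, |v i| := by
  rw [EuclideanSpace.norm_eq]
  refine Real.sqrt_le_iff.2 ⟨Finset.sum_nonneg fun i _ => abs_nonneg _, ?_⟩
  simp only [Real.norm_eq_abs]
  exact Finset.sum_sq_le_sq_sum_of_nonneg fun i _ => abs_nonneg _

theorem EuclideanSpace.dist_le_sqrt_mul {n : ℕ} {x y : EuclideanSpace ℝ (Fin n)} {c : ℝ}
    (hc : 0 ≤ c) (h : ∀ i, |x i - y i| ≤ c) : dist x y ≤ √n * c := by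
  rw [EuclideanSpace.dist_eq]
  refine Real.sqrt_le_iff.2 ⟨by positivity, ?_⟩
  rw [mul_pow, Real.sq_sqrt (by positivity)]
  calc ∑ i, dist (x i) (y i) ^ 2 ≤ ∑ _i : Fin n, c ^ 2 :=
        Finset.sum_le_sum fun i _ => by
          rw [Real.dist_eq]; exact pow_le_pow_left₀ (abs_nonneg _) (h i) 2
    _ = n * c ^ 2 := by simp

/-! ### Cubes indexed by digit sequences -/

section Digits

variable {b : ℕ} {l : ℝ}

/-- The point of `[0, 1]` with digits `x j`, in the Cantor set generated by the `b` intervals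
`[2 l i, 2 l i + l]`, `i < b`; these are disjoint intervals of `[0, 1]` when `2 b l ≤ 1`. -/
noncomputable def digitSum (l : ℝ) (x : ℕ → Fin b) : ℝ := ∑' j, 2 * l * l ^ j * (x j : ℝ)

theorem two_mul_mul_digit_le (hl : 0 < l) (hbl : 2 * b * l ≤ 1) (x : Fin b) :
    2 * l * (x : ℝ) ≤ 1 - 2 * l := by
  have : (x : ℝ) + 1 ≤ b := by exact_mod_cast x.2
  nlinarith

theorem digitSum_term_le (hl : 0 < l) (hbl : 2 * b * l ≤ 1) (x : ℕ → Fin b) (j : ℕ) :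
    2 * l * l ^ j * (x j : ℝ) ≤ (1 - 2 * l) * l ^ j := by
  have := mul_le_mul_of_nonneg_right (two_mul_mul_digit_le hl hbl (x j)) (pow_nonneg hl.le j)
  linarith

theorem two_mul_le_one_of_fin (hl : 0 < l) (hbl : 2 * b * l ≤ 1) (x : Fin b) : 2 * l ≤ 1 := by
  have : (0 : ℝ) ≤ (x : ℝ) := by positivity
  nlinarith [two_mul_mul_digit_le hl hbl x]

theorem summable_digitSum (hl : 0 < l) (hbl : 2 * b * l ≤ 1) (x : ℕ → Fin b) :
    Summable fun j => 2 * l * l ^ j * (x j : ℝ) :=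
  Summable.of_nonneg_of_le (fun j => by positivity) (digitSum_term_le hl hbl x)
    ((summable_geometric_of_lt_one hl.le (by linarith [two_mul_le_one_of_fin hl hbl (x 0)])).mul_left _)

theorem digitSum_mem_Icc (hl : 0 < l) (hbl : 2 * b * l ≤ 1) (x : ℕ → Fin b) :
    digitSum l x ∈ Icc (0 : ℝ) 1 := by
  have h2 := two_mul_le_one_of_fin hl hbl (x 0)
  have hl1 : l < 1 := by linarith
  refine ⟨tsum_nonneg fun j => by positivity, ?_⟩
  refine ((summable_digitSum hl hbl x).tsum_le_tsum (digitSum_term_le hl hbl x)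
    ((summable_geometric_of_lt_one hl.le hl1).mul_left _)).trans ?_
  rw [tsum_mul_left, tsum_geometric_of_lt_one hl.le hl1, ← div_eq_mul_inv,
    div_le_one (by linarith)]
  linarith

/-- Sequences that differ for the first time at index `k` give points at distance `≥ l ^ (k + 1)`:
the term of index `k` contributes at least `2 l ^ (k + 1)`, and the tail at most `l ^ (k + 1)`. -/
theorem pow_succ_le_abs_digitSum_sub (hl : 0 < l) (hbl : 2 * b * l ≤ 1) {x y : ℕ → Fin b}
    {k : ℕ} (heq : ∀ j < k, x j = y j) (hne : x k ≠ y k) :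
    l ^ (k + 1) ≤ |digitSum l x - digitSum l y| := by
  have h2 := two_mul_le_one_of_fin hl hbl (x 0)
  have hl1 : l < 1 := by linarith
  have hsx := summable_digitSum hl hbl x
  have hsy := summable_digitSum hl hbl y
  set z : ℕ → ℝ := fun j => 2 * l * l ^ j * (x j : ℝ) - 2 * l * l ^ j * (y j : ℝ) with hz
  have hs : Summable z := hsx.sub hsy
  have hD : digitSum l x - digitSum l y = ∑' j, z j := (hsx.tsum_sub hsy).symm
  rw [hD, ← hs.sum_add_tsum_nat_add (k + 1), Finset.sum_range_succ,
    Finset.sum_eq_zero fun j hj => by simp [hz, heq j (Finset.mem_range.1 hj)], zero_add]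
  have habs : ∀ j, ‖z j‖ ≤ (1 - 2 * l) * l ^ j := fun j => by
    have h1 := digitSum_term_le hl hbl x j
    have h2 := digitSum_term_le hl hbl y j
    have h3 : 0 ≤ 2 * l * l ^ j * (x j : ℝ) := by positivity
    have h4 : 0 ≤ 2 * l * l ^ j * (y j : ℝ) := by positivity
    rw [Real.norm_eq_abs, abs_le]
    constructor <;> simp only [hz] <;> linarith
  have htail : |∑' j, z (j + (k + 1))| ≤ l ^ (k + 1) := by
    have hg := (((hasSum_geometric_of_lt_one hl.le hl1).mul_left (l ^ (k + 1))).mul_left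
      (1 - 2 * l))
    have := tsum_of_norm_bounded hg fun j => (habs (j + (k + 1))).trans
      (by rw [pow_add, mul_comm (l ^ j)])
    rw [Real.norm_eq_abs] at this
    refine this.trans ?_
    rw [mul_left_comm]
    refine mul_le_of_le_one_right (by positivity) ?_
    rw [← div_eq_mul_inv, div_le_one (by linarith)]
    linarith
  have hmain : 2 * l ^ (k + 1) ≤ |z k| := by
    have h1 : (1 : ℝ) ≤ |(x k : ℝ) - (y k : ℝ)| := by
      have : (1 : ℤ) ≤ |((x k : ℕ) : ℤ) - ((y k : ℕ) : ℤ)| := by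
        refine Int.one_le_abs (sub_ne_zero.2 ?_)
        exact_mod_cast fun h => hne (Fin.ext h)
      exact_mod_cast this
    have : z k = 2 * l ^ (k + 1) * ((x k : ℝ) - (y k : ℝ)) := by simp only [hz]; ring
    rw [this, abs_mul, abs_of_pos (by positivity : 0 < 2 * l ^ (k + 1))]
    exact le_mul_of_one_le_right (by positivity) h1
  have := abs_sub_abs_le_abs_sub (z k) (-∑' j, z (j + (k + 1)))
  rw [abs_neg, sub_neg_eq_add] at this
  linarith

end Digits

/-- If `κ k x` is the label at level `k` of the point `x`, and a label has at most `card D` labels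
below it at the next level, then these can be numbered by digits in `D`. The labels need not be
nested. -/
theorem exists_digits {X Y D : Type*} [Fintype D] [Nonempty D] (κ : ℕ → X → Y)
    (hcard : ∀ k x, ∀ T : Finset Y, (∀ c ∈ T, ∃ y, κ k y = κ k x ∧ κ (k + 1) y = c) →
      T.card ≤ Fintype.card D) :
    ∃ d : ℕ → X → D, ∀ k x y, κ k x = κ k y → (d k x = d k y ↔ κ (k + 1) x = κ (k + 1) y) := by
  have : ∀ k x, ∃ φ : Y → D, InjOn φ {c | ∃ y, κ k y = κ k x ∧ κ (k + 1) y = c} := by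
    intro k x
    set S := {c | ∃ y, κ k y = κ k x ∧ κ (k + 1) y = c}
    have hfin : S.Finite := by
      by_contra hinf
      obtain ⟨T, hT, hTc⟩ := Set.Infinite.exists_subset_card_eq hinf (Fintype.card D + 1)
      have := hcard k x T fun c hc => hT hc
      omega
    obtain ⟨φ, -, hφ⟩ := hfin.exists_injOn_of_encard_le (t := (univ : Set D)) (by
      rw [hfin.encard_eq_coe_toFinset_card, encard_univ, ENat.card_eq_coe_fintype_card]
      exact_mod_cast hcard k x hfin.toFinset fun c hc => hfin.mem_toFinset.1 hc)
    exact ⟨φ, hφ⟩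
  have : ∀ k (p : Y), ∃ φ : Y → D, InjOn φ {c | ∃ y, κ k y = p ∧ κ (k + 1) y = c} := by
    intro k p
    by_cases h : ∃ x, κ k x = p
    · obtain ⟨x, rfl⟩ := h
      exact this k x
    · refine ⟨fun _ => Classical.arbitrary D, ?_⟩
      rintro c ⟨y, hy, -⟩
      exact absurd ⟨y, hy⟩ h
  choose φ hφ using this
  refine ⟨fun k x => φ k (κ k x) (κ (k + 1) x), fun k x y hxy => ⟨fun h => ?_, fun h => ?_⟩⟩
  · refine hφ k (κ k x) ⟨x, rfl, rfl⟩ ⟨y, hxy.symm, rfl⟩ ?_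
    simpa [hxy] using h
  · simp only [hxy, h]

/-! ### Homogeneous sets lie in Hölder cubes -/

/-- The `N`-adic cube of side `N ^ (-k)` containing `x`. At level `0` all points have the same
label, so that a set of diameter at most `1` has a single cell there wherever it is located. -/
noncomputable def gridCell {n : ℕ} (N : ℕ) : ℕ → EuclideanSpace ℝ (Fin n) → Fin n → ℤ
  | 0, _ => 0
  | k + 1, x => fun i => ⌊(N : ℝ) ^ (k + 1) * x i⌋

theorem dist_le_of_gridCell_eq {n N k : ℕ} (hn : n ≠ 0) (hN : N ≠ 0)
    {x y : EuclideanSpace ℝ (Fin n)} (hxy : dist x y ≤ 1) (h : gridCell N k x = gridCell N k y) :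
    dist x y ≤ √n * ((N : ℝ) ^ k)⁻¹ := by
  cases k with
  | zero =>
    have : (1 : ℝ) ≤ √n := Real.one_le_sqrt.2 (by exact_mod_cast Nat.one_le_iff_ne_zero.2 hn)
    simpa using hxy.trans this
  | succ k =>
    refine EuclideanSpace.dist_le_sqrt_mul (by positivity) fun i => ?_
    have h1 := Int.abs_sub_lt_one_of_floor_eq_floor (congr_fun h i)
    have hNp : (0 : ℝ) < (N : ℝ) ^ (k + 1) := by positivity
    rw [← mul_sub, abs_mul, abs_of_pos hNp] at h1
    rw [← one_div, le_div_iff₀' hNp]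
    exact h1.le

/-- A cell meeting a homogeneous set has `O(N ^ t)` subcells meeting it. Points chosen in distinct
subcells are separated by the side of the subcells once the indices of the subcells have the same
parities, which accounts for the factor `2 ^ n`. -/
theorem card_children_gridCell_le {n N : ℕ} (hn : n ≠ 0) (hN : N ≠ 0) {C t : ℝ} (hC : 0 ≤ C)
    {A : Set (EuclideanSpace ℝ (Fin n))} (hA : HomogeneousWith C t A)
    (hdiam : ∀ x ∈ A, ∀ y ∈ A, dist x y ≤ 1) {k : ℕ} {x : EuclideanSpace ℝ (Fin n)} (hx : x ∈ A)
    (T : Finset (Fin n → ℤ))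
    (hT : ∀ c ∈ T, ∃ y ∈ A, gridCell N k y = gridCell N k x ∧ gridCell N (k + 1) y = c) :
    (T.card : ℝ) ≤ 2 ^ n * C * √n ^ t * (N : ℝ) ^ t := by
  classical
  have hNpos : (0 : ℝ) < N := by positivity
  have hN1 : (1 : ℝ) ≤ N := by exact_mod_cast Nat.one_le_iff_ne_zero.2 hN
  have hn1 : (1 : ℝ) ≤ √n := Real.one_le_sqrt.2 (by exact_mod_cast Nat.one_le_iff_ne_zero.2 hn)
  have hB0 : 0 ≤ C * (√n * N) ^ t := by positivity
  let par : (Fin n → ℤ) → Fin n → Bool := fun c i => decide (Even (c i))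
  have hfib : ∀ p ∈ T.image par, (T.filter fun c => par c = p).card ≤ ⌊C * (√n * N) ^ t⌋₊ := by
    intro p _
    set T' := T.filter fun c => par c = p with hT'
    have hch : ∀ c : Fin n → ℤ, ∃ y : EuclideanSpace ℝ (Fin n), c ∈ T' → y ∈ A ∧
        gridCell N k y = gridCell N k x ∧ gridCell N (k + 1) y = c := fun c => by
      by_cases hc : c ∈ T'
      · obtain ⟨y, hy⟩ := hT c (Finset.mem_filter.1 hc).1
        exact ⟨y, fun _ => hy⟩
      · exact ⟨0, fun h => absurd h hc⟩
    choose y hy using hch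
    have hinj : InjOn y T' := fun c hc c' hc' h => by
      rw [← (hy c hc).2.2, ← (hy c' hc').2.2, h]
    rw [← Finset.card_image_of_injOn hinj]
    refine Nat.le_floor ?_
    have hrad : √n * ((N : ℝ) ^ k)⁻¹ / ((N : ℝ) ^ (k + 1))⁻¹ = √n * N := by
      field_simp
      exact pow_succ _ _
    rw [← hrad]
    refine hA x hx _ _ (by positivity) ?_ _ ?_ ?_ ?_
    · calc ((N : ℝ) ^ (k + 1))⁻¹ ≤ 1 * ((N : ℝ) ^ k)⁻¹ := by
            rw [one_mul]
            exact inv_anti₀ (by positivity) (pow_le_pow_right₀ hN1 (Nat.le_succ k))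
        _ ≤ _ := mul_le_mul_of_nonneg_right hn1 (by positivity)
    · intro z hz
      obtain ⟨c, hc, rfl⟩ := Finset.mem_image.1 hz
      exact (hy c hc).1
    · intro z hz
      obtain ⟨c, hc, rfl⟩ := Finset.mem_image.1 hz
      exact dist_le_of_gridCell_eq hn hN (hdiam _ (hy c hc).1 _ hx) (hy c hc).2.1
    · intro z hz z' hz' hne
      obtain ⟨c, hc, rfl⟩ := Finset.mem_image.1 hz
      obtain ⟨c', hc', rfl⟩ := Finset.mem_image.1 hz'
      have hcc : c ≠ c' := fun h => hne (by rw [h])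
      obtain ⟨i, hi⟩ := Function.ne_iff.1 hcc
      have hpar : Even (c i) ↔ Even (c' i) := by
        have h1 := congr_fun ((Finset.mem_filter.1 hc).2.trans (Finset.mem_filter.1 hc').2.symm) i
        simpa [par] using h1
      have hfl : ∀ c ∈ T', ⌊(N : ℝ) ^ (k + 1) * y c i⌋ = c i := fun c hc =>
        congr_fun (hy c hc).2.2 i
      have h2 : 1 ≤ |(N : ℝ) ^ (k + 1) * y c i - (N : ℝ) ^ (k + 1) * y c' i| := by
        have e1 := Int.floor_le ((N : ℝ) ^ (k + 1) * y c i)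
        have e2 := Int.lt_floor_add_one ((N : ℝ) ^ (k + 1) * y c i)
        have e3 := Int.floor_le ((N : ℝ) ^ (k + 1) * y c' i)
        have e4 := Int.lt_floor_add_one ((N : ℝ) ^ (k + 1) * y c' i)
        rw [hfl c hc] at e1 e2
        rw [hfl c' hc'] at e3 e4
        rw [Int.even_iff, Int.even_iff] at hpar
        rcases lt_or_gt_of_ne hi with h | h
        · have : c i + 2 ≤ c' i := by omega
          have : (c i : ℝ) + 2 ≤ c' i := by exact_mod_cast this
          rw [abs_sub_comm]
          exact le_trans (by linarith) (le_abs_self _)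
        · have : c' i + 2 ≤ c i := by omega
          have : (c' i : ℝ) + 2 ≤ c i := by exact_mod_cast this
          exact le_trans (by linarith) (le_abs_self _)
      rw [← mul_sub, abs_mul, abs_of_pos (by positivity)] at h2
      rw [inv_le_iff_one_le_mul₀' (by positivity)]
      refine h2.trans (mul_le_mul_of_nonneg_left ?_ (by positivity))
      rw [dist_eq_norm]
      exact EuclideanSpace.abs_apply_le_norm (y c - y c') i
  have h1 := Finset.card_le_mul_card_image T _ hfib
  have h2 : (T.image par).card ≤ 2 ^ n := by
    refine (Finset.card_le_univ _).trans ?_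
    simp
  have h3 : (⌊C * (√n * N) ^ t⌋₊ : ℝ) ≤ C * (√n * N) ^ t := Nat.floor_le hB0
  calc (T.card : ℝ) ≤ (⌊C * (√n * N) ^ t⌋₊ : ℝ) * ((T.image par).card : ℝ) := by exact_mod_cast h1
    _ ≤ (C * (√n * N) ^ t) * 2 ^ n := by
        refine mul_le_mul h3 (by exact_mod_cast h2) (by positivity) hB0
    _ = _ := by rw [Real.mul_rpow (by positivity) (by positivity)]; ring

theorem exists_holderOnWith_extension {V : Type*} [SeminormedAddCommGroup V] {n : ℕ} {ι : Type*} 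
    [Nonempty ι] {p : ι → V} {a : ι → EuclideanSpace ℝ (Fin n)} {K α : ℝ}
    (hK : 0 ≤ K) (hα0 : 0 < α) (hα1 : α ≤ 1)
    (h : ∀ i j, dist (a i) (a j) ≤ K * dist (p i) (p j) ^ α) :
    ∃ f : V → EuclideanSpace ℝ (Fin n), (∀ i, f (p i) = a i) ∧
      ∀ x y, dist (f x) (f y) ≤ n * K * dist x y ^ α := by
  have hq : ∀ u v : V, K * ‖u + v‖ ^ α ≤ K * ‖u‖ ^ α + K * ‖v‖ ^ α := by
    intro u v
    rw [← mul_add]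
    refine mul_le_mul_of_nonneg_left ?_ hK
    exact (Real.rpow_le_rpow (norm_nonneg _) (norm_add_le u v) hα0.le).trans
      (Real.rpow_add_le_add_rpow (norm_nonneg _) (norm_nonneg _) hα0.le hα1)
  have hext := fun c : Fin n => exists_extension_of_subadditive
    (fun v : V => K * ‖v‖ ^ α) (by simp [Real.zero_rpow hα0.ne']) hq p
    (fun i => a i c) (fun i j => by
      rw [← dist_eq_norm]
      refine le_trans ?_ (h i j)
      rw [dist_eq_norm]
      exact (le_abs_self _).trans (EuclideanSpace.abs_apply_le_norm (a i - a j) c))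
  choose G hG hGq using hext
  refine ⟨fun x => WithLp.toLp 2 fun c => G c x, fun i => ?_, fun x y => ?_⟩
  · ext c
    exact hG c i
  · rw [dist_eq_norm]
    refine (EuclideanSpace.norm_le_sum_abs _).trans ?_
    have : ∀ c ∈ (Finset.univ : Finset (Fin n)), |G c x - G c y| ≤ K * dist x y ^ α := by
      intro c _
      rw [abs_sub_le_iff, dist_eq_norm]
      refine ⟨hGq c x y, ?_⟩
      rw [norm_sub_rev]
      exact hGq c y x
    simpa [mul_assoc] using Finset.sum_le_sum this

theorem holderOnWith_of_dist_le {X Y : Type*} [PseudoMetricSpace X] [PseudoMetricSpace Y]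
    {f : X → Y} {K α : ℝ} (hα : 0 ≤ α)
    (h : ∀ x y, dist (f x) (f y) ≤ K * dist x y ^ α) (S : Set X) :
    HolderOnWith K.toNNReal α.toNNReal f S := by
  intro x _ y _
  rw [edist_dist, edist_dist, Real.coe_toNNReal _ hα,
    ENNReal.ofReal_rpow_of_nonneg dist_nonneg hα, ← ENNReal.ofReal.eq_1 K,
    ← ENNReal.ofReal_mul' (by positivity)]
  exact ENNReal.ofReal_le_ofReal (h x y)

/-- Since `t < s`, for `N` large a cube has room for `M N ^ t` separated subcubes whose side is
`N ^ (-(s / m))` times its own. -/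
theorem exists_scale {m : ℕ} (hm : 1 ≤ m) {s t : ℝ} (hms : (m : ℝ) ≤ s) (hts : t < s) (M : ℝ) :
    ∃ (N b : ℕ), 2 ≤ N ∧ 1 ≤ b ∧ 2 * b * (N : ℝ) ^ (-(s / m)) ≤ 1 ∧ M * (N : ℝ) ^ t ≤ (b : ℝ) ^ m := by
  have hm0 : (0 : ℝ) < m := by exact_mod_cast hm
  have hlim : Tendsto (fun N : ℕ => (N : ℝ) ^ (s - t)) atTop atTop :=
    (tendsto_rpow_atTop (sub_pos.2 hts)).comp tendsto_natCast_atTop_atTop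
  obtain ⟨N, hN, hN4⟩ := ((hlim.eventually_ge_atTop (4 ^ m * M)).and
    (eventually_ge_atTop 4)).exists
  have hN4' : (4 : ℝ) ≤ N := by exact_mod_cast hN4
  have hN0 : (0 : ℝ) < N := by linarith
  set z : ℝ := (N : ℝ) ^ (s / m) with hz
  have hz4 : 4 ≤ z := hN4'.trans
    (Real.self_le_rpow_of_one_le (by linarith) ((one_le_div hm0).2 hms))
  have hb1 : (⌊z / 2⌋₊ : ℝ) ≤ z / 2 := Nat.floor_le (by linarith)
  have hb2 : z / 2 - 1 < (⌊z / 2⌋₊ : ℝ) := Nat.sub_one_lt_floor _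
  refine ⟨N, ⌊z / 2⌋₊, by omega, Nat.le_floor (by push_cast; linarith), ?_, ?_⟩
  · rw [Real.rpow_neg hN0.le, ← hz, ← div_eq_mul_inv, div_le_one (by linarith)]
    linarith
  · calc M * (N : ℝ) ^ t ≤ (z / 4) ^ m := by
          have hzm : z ^ m = (N : ℝ) ^ s := by
            rw [hz, ← Real.rpow_mul_natCast hN0.le, div_mul_cancel₀ _ hm0.ne']
          rw [div_pow, le_div_iff₀ (by positivity), hzm]
          have : (N : ℝ) ^ s = (N : ℝ) ^ (s - t) * (N : ℝ) ^ t := by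
            rw [← Real.rpow_add hN0]; ring_nf
          rw [this]
          have := mul_le_mul_of_nonneg_right hN (Real.rpow_nonneg hN0.le t)
          linarith
      _ ≤ _ := pow_le_pow_left₀ (by linarith) (by linarith) _

/-- The digits of the `N`-adic cells send `A` into a Cantor subset of `[0, 1]ᵐ` with contraction ratio
`l = N ^ (-(s / m))`. The inverse of this map is `(m / s)`-Hölder, because `l ^ (m / s) = N⁻¹`, and
extends to the whole cube. -/
theorem HomogeneousWith.exists_isHolderCube {m n : ℕ} (hm : 1 ≤ m) (hn : n ≠ 0) {s t : ℝ}
    (hms : (m : ℝ) ≤ s) (hts : t < s) {C : ℝ}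
    {A : Set (EuclideanSpace ℝ (Fin n))} (hA : HomogeneousWith C t A)
    (hdiam : ∀ x ∈ A, ∀ y ∈ A, dist x y ≤ 1) :
    ∃ Γ, IsHolderCube m s Γ ∧ A ⊆ Γ := by
  have hm0 : (0 : ℝ) < m := by exact_mod_cast hm
  have hs0 : 0 < s := hm0.trans_le hms
  rcases A.eq_empty_or_nonempty with rfl | hne
  · refine ⟨_, ⟨fun _ => 0, (0 : ℝ).toNNReal, holderOnWith_of_dist_le (by positivity) ?_ _, rfl⟩,
      empty_subset _⟩
    simp
  have : Nonempty A := hne.to_subtype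
  have hC : 0 ≤ C := by
    obtain ⟨x, hx⟩ := hne
    simpa using hA x hx 1 1 one_pos le_rfl ∅ (by simp) (by simp) (by simp)
  obtain ⟨N, b, hN, hb, hbl, hM⟩ := exists_scale hm hms hts (2 ^ n * C * √n ^ t)
  have hN0 : N ≠ 0 := by omega
  have hNpos : (0 : ℝ) < N := by positivity
  set l : ℝ := (N : ℝ) ^ (-(s / m)) with hl
  have hl0 : 0 < l := Real.rpow_pos_of_pos hNpos _
  have : Nonempty (Fin b) := ⟨⟨0, hb⟩⟩
  obtain ⟨d, hd⟩ := exists_digits (D := Fin m → Fin b)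
    (fun k (x : A) => gridCell N k (x : EuclideanSpace ℝ (Fin n))) (by
      intro k x T hT
      have := (card_children_gridCell_le hn hN0 hC hA hdiam x.2 (k := k) T fun c hc => by
        obtain ⟨y, h1, h2⟩ := hT c hc
        exact ⟨y, y.2, h1, h2⟩).trans hM
      simpa using (by exact_mod_cast this : T.card ≤ b ^ m))
  set p : A → EuclideanSpace ℝ (Fin m) := fun a =>
    WithLp.toLp 2 fun i => digitSum l fun k => d k a i with hp
  have hlpow : l ^ ((m : ℝ) / s) = (N : ℝ)⁻¹ := by
    rw [hl, ← Real.rpow_mul hNpos.le, neg_mul, div_mul_div_cancel₀ hm0.ne', div_self hs0.ne',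
      Real.rpow_neg_one]
  have hα1 : (m : ℝ) / s ≤ 1 := (div_le_one hs0).2 hms
  have hα0 : 0 < (m : ℝ) / s := div_pos hm0 hs0
  have hmain : ∀ x y : A, dist (x : EuclideanSpace ℝ (Fin n)) y
      ≤ √n * N * dist (p x) (p y) ^ ((m : ℝ) / s) := by
    intro x y
    by_cases hxy : ∀ k, gridCell N k (x : EuclideanSpace ℝ (Fin n)) = gridCell N k y
    · have h0 : dist (x : EuclideanSpace ℝ (Fin n)) y ≤ 0 := by
        have hlim : Tendsto (fun k : ℕ => √n * ((N : ℝ) ^ k)⁻¹) atTop (𝓝 0) := by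
          have := (tendsto_pow_atTop_nhds_zero_of_lt_one (r := (N : ℝ)⁻¹) (by positivity)
            (inv_lt_one_of_one_lt₀ (by exact_mod_cast hN))).const_mul √n
          simpa using this
        exact ge_of_tendsto' hlim fun k =>
          dist_le_of_gridCell_eq hn hN0 (hdiam _ x.2 _ y.2) (hxy k)
      exact h0.trans (by positivity)
    -- Otherwise, compare at the first level `k + 1` at which the cells differ.
    · push Not at hxy
      classical
      obtain ⟨k, hk⟩ : ∃ k, Nat.find hxy = k + 1 := Nat.exists_eq_succ_of_ne_zero fun h0 => by
        have := Nat.find_spec hxy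
        rw [h0] at this
        exact this rfl
      have hlt : ∀ j ≤ k, gridCell N j (x : EuclideanSpace ℝ (Fin n)) = gridCell N j y :=
        fun j hj => not_not.1 (Nat.find_min hxy (by omega))
      have hkne := Nat.find_spec hxy
      rw [hk] at hkne
      have hdne : d k x ≠ d k y := fun h => hkne ((hd k x y (hlt k le_rfl)).1 h)
      obtain ⟨i, hi⟩ := Function.ne_iff.1 hdne
      have hsep := pow_succ_le_abs_digitSum_sub hl0 hbl (x := fun k => d k x i)
        (y := fun k => d k y i) (k := k)
        (fun j hj => congr_fun ((hd j x y (hlt j hj.le)).2 (hlt (j + 1) hj)) i) hi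
      have hpd : l ^ (k + 1) ≤ dist (p x) (p y) := by
        rw [dist_eq_norm]
        exact hsep.trans (EuclideanSpace.abs_apply_le_norm (p x - p y) i)
      have hpow := Real.rpow_le_rpow (by positivity) hpd hα0.le
      rw [← Real.rpow_pow_comm hl0.le, hlpow] at hpow
      calc dist (x : EuclideanSpace ℝ (Fin n)) y ≤ √n * ((N : ℝ) ^ k)⁻¹ :=
            dist_le_of_gridCell_eq hn hN0 (hdiam _ x.2 _ y.2) (hlt k le_rfl)
        _ = √n * N * (N : ℝ)⁻¹ ^ (k + 1) := by
            rw [pow_succ, inv_pow]; field_simp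
        _ ≤ _ := mul_le_mul_of_nonneg_left hpow (by positivity)
  obtain ⟨f, hf, hfH⟩ := exists_holderOnWith_extension (by positivity) hα0 hα1 hmain
  refine ⟨f '' unitCube m, ⟨f, _, holderOnWith_of_dist_le hα0.le hfH _, rfl⟩, fun x hx => ?_⟩
  refine ⟨p ⟨x, hx⟩, fun i => ?_, hf ⟨x, hx⟩⟩
  exact digitSum_mem_Icc hl0 hbl _

/-! ### The order by gaps -/

section GapOrder

variable {X : Type*} (f : ℕ → X → ℝ) (δ : ℕ → ℝ)

/-- Nested equivalence relations on `X`: the classes at level `j + 1` are obtained by cutting each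
class at level `j` along the gaps of radius `δ j` in its image under `f j`. That is, `a` and `b` stay
together when each value between `f j a` and `f j b` is within `δ j` of the value of `f j` at some
point of their class. -/
def gapRel : ℕ → X → X → Prop
  | 0, _, _ => True
  | j + 1, a, b => gapRel j a b ∧
      ∀ w ∈ uIcc (f j a) (f j b), ∃ v, gapRel j a v ∧ |f j v - w| ≤ δ j

/-- The points `a` and `b` are separated exactly when passing from level `k` to level `k + 1`, and
`f k a < f k b`. The union over `k` is the lexicographic order of the tree of classes. -/
def gapLT (k : ℕ) (a b : X) : Prop :=
  gapRel f δ k a b ∧ ¬ gapRel f δ (k + 1) a b ∧ f k a < f k b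

variable {f δ}

theorem gapRel_equivalence (hδ : ∀ j, 0 ≤ δ j) (j : ℕ) : Equivalence (gapRel f δ j) := by
  induction j with
  | zero => exact ⟨fun _ => trivial, fun _ => trivial, fun _ _ => trivial⟩
  | succ j ih =>
    refine ⟨fun a => ⟨ih.refl a, fun w hw => ⟨a, ih.refl a, ?_⟩⟩, fun {a b} h => ⟨ih.symm h.1, ?_⟩,
      fun {a b c} hab hbc => ⟨ih.trans hab.1 hbc.1, fun w hw => ?_⟩⟩
    · rw [uIcc_self, mem_singleton_iff] at hw
      simpa [hw] using hδ j
    · intro w hw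
      rw [uIcc_comm] at hw
      obtain ⟨v, hv, hvw⟩ := h.2 w hw
      exact ⟨v, ih.trans (ih.symm h.1) hv, hvw⟩
    · rcases uIcc_subset_uIcc_union_uIcc (b := f j b) hw with hw | hw
      · exact hab.2 w hw
      · obtain ⟨v, hv, hvw⟩ := hbc.2 w hw
        exact ⟨v, ih.trans hab.1 hv, hvw⟩

theorem gapRel_of_le {j k : ℕ} (hjk : j ≤ k) {a b : X} (h : gapRel f δ k a b) :
    gapRel f δ j a b := by
  induction hjk with
  | refl => exact h
  | step _ ih => exact ih h.1

theorem exists_gapRel_not_succ {j : ℕ} {a b : X} (h : ¬ gapRel f δ j a b) :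
    ∃ k < j, gapRel f δ k a b ∧ ¬ gapRel f δ (k + 1) a b := by
  induction j with
  | zero => exact absurd trivial h
  | succ j ih =>
    by_cases hj : gapRel f δ j a b
    · exact ⟨j, j.lt_succ_self, hj, h⟩
    · obtain ⟨k, hk, h'⟩ := ih hj
      exact ⟨k, hk.trans j.lt_succ_self, h'⟩

theorem gapRel_not_succ_unique {k l : ℕ} {a b : X} (hk : gapRel f δ k a b)
    (hk' : ¬ gapRel f δ (k + 1) a b) (hl : gapRel f δ l a b) (hl' : ¬ gapRel f δ (l + 1) a b) :
    k = l := by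
  rcases lt_trichotomy k l with h | h | h
  · exact absurd (gapRel_of_le h hl) hk'
  · exact h
  · exact absurd (gapRel_of_le h hk) hl'

theorem exists_gap {k : ℕ} {a b : X} (hk : gapRel f δ k a b) (hk' : ¬ gapRel f δ (k + 1) a b) :
    ∃ w ∈ uIcc (f k a) (f k b), ∀ v, gapRel f δ k a v → δ k < |f k v - w| := by
  by_contra! h
  exact hk' ⟨hk, fun w hw => h w hw⟩

theorem two_mul_le_abs_of_gap (hδ : ∀ j, 0 ≤ δ j) {k : ℕ} {a b : X} (hk : gapRel f δ k a b)
    (hk' : ¬ gapRel f δ (k + 1) a b) : 2 * δ k ≤ |f k a - f k b| := by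
  obtain ⟨w, hw, h⟩ := exists_gap hk hk'
  have ha := h a ((gapRel_equivalence hδ k).refl a)
  have hb := h b hk
  rcases mem_uIcc.1 hw with ⟨h1, h2⟩ | ⟨h1, h2⟩
  · rw [abs_of_nonpos (sub_nonpos.2 h1)] at ha
    rw [abs_of_nonneg (sub_nonneg.2 h2)] at hb
    rw [abs_of_nonpos (sub_nonpos.2 (h1.trans h2))]
    linarith
  · rw [abs_of_nonneg (sub_nonneg.2 h2)] at ha
    rw [abs_of_nonpos (sub_nonpos.2 h1)] at hb
    rw [abs_of_nonneg (sub_nonneg.2 (h1.trans h2))]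
    linarith

theorem gapLT.exists_between (hδ : ∀ j, 0 ≤ δ j) {k : ℕ} {a b : X} (h : gapLT f δ k a b) :
    ∃ w, f k a < w ∧ w < f k b ∧ ∀ v, gapRel f δ k a v → δ k < |f k v - w| := by
  obtain ⟨w, hw, hg⟩ := exists_gap h.1 h.2.1
  rw [uIcc_of_le h.2.2.le] at hw
  have ha := (hδ k).trans_lt (hg a ((gapRel_equivalence hδ k).refl a))
  have hb := (hδ k).trans_lt (hg b h.1)
  rw [abs_pos, sub_ne_zero] at ha hb
  exact ⟨w, lt_of_le_of_ne hw.1 ha, lt_of_le_of_ne hw.2 hb.symm, hg⟩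

theorem gapLT.congr_left (hδ : ∀ j, 0 ≤ δ j) {k : ℕ} {a a' b : X} (h : gapLT f δ k a b)
    (ha : gapRel f δ (k + 1) a a') : gapLT f δ k a' b := by
  have e := gapRel_equivalence (f := f) hδ k
  have e' := gapRel_equivalence (f := f) hδ (k + 1)
  refine ⟨e.trans (e.symm ha.1) h.1, fun h' => h.2.1 (e'.trans ha h'), ?_⟩
  obtain ⟨w, hw1, hw2, hg⟩ := h.exists_between hδ
  refine lt_of_not_ge fun hle => ?_
  obtain ⟨v, hv, hvw⟩ := ha.2 w (mem_uIcc.2 (Or.inl ⟨hw1.le, hw2.le.trans hle⟩))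
  exact absurd hvw (not_le.2 (hg v hv))

theorem gapLT.congr_right (hδ : ∀ j, 0 ≤ δ j) {k : ℕ} {a b b' : X} (h : gapLT f δ k a b)
    (hb : gapRel f δ (k + 1) b b') : gapLT f δ k a b' := by
  have e := gapRel_equivalence (f := f) hδ k
  have e' := gapRel_equivalence (f := f) hδ (k + 1)
  refine ⟨e.trans h.1 hb.1, fun h' => h.2.1 (e'.trans h' (e'.symm hb)), ?_⟩
  obtain ⟨w, hw1, hw2, hg⟩ := h.exists_between hδ
  refine lt_of_not_ge fun hle => ?_
  obtain ⟨v, hv, hvw⟩ := hb.2 w (mem_uIcc.2 (Or.inr ⟨hle.trans hw1.le, hw2.le⟩))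
  exact absurd hvw (not_le.2 (hg v (e.trans h.1 hv)))

theorem gapLT.trans (hδ : ∀ j, 0 ≤ δ j) {k l : ℕ} {a b c : X} (hab : gapLT f δ k a b) (hbc : gapLT f δ l b c) :
    gapLT f δ (min k l) a c := by
  rcases lt_trichotomy k l with h | rfl | h
  · rw [min_eq_left h.le]
    exact hab.congr_right hδ (gapRel_of_le h hbc.1)
  · rw [min_self]
    have e := gapRel_equivalence (f := f) hδ k
    refine ⟨e.trans hab.1 hbc.1, fun h' => ?_, hab.2.2.trans hbc.2.2⟩
    obtain ⟨w, hw1, hw2, hg⟩ := hab.exists_between hδ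
    obtain ⟨v, hv, hvw⟩ := h'.2 w (mem_uIcc.2 (Or.inl ⟨hw1.le, hw2.le.trans hbc.2.2.le⟩))
    exact absurd hvw (not_le.2 (hg v hv))
  · rw [min_eq_right h.le]
    exact hbc.congr_left hδ ((gapRel_equivalence hδ _).symm (gapRel_of_le h hab.1))

theorem gapLT_or_gapLT (hδ : ∀ j, 0 ≤ δ j) {k : ℕ} {a b : X} (hk : gapRel f δ k a b)
    (hk' : ¬ gapRel f δ (k + 1) a b) : gapLT f δ k a b ∨ gapLT f δ k b a := by
  have e := gapRel_equivalence (f := f) hδ k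
  have e' := gapRel_equivalence (f := f) hδ (k + 1)
  have hne : f k a ≠ f k b := by
    intro h
    obtain ⟨w, hw, hg⟩ := exists_gap hk hk'
    rw [h, uIcc_self, mem_singleton_iff] at hw
    have := hg b hk
    rw [hw, sub_self, abs_zero] at this
    exact absurd (hδ k) (not_le.2 this)
  rcases lt_or_gt_of_ne hne with h | h
  · exact Or.inl ⟨hk, hk', h⟩
  · exact Or.inr ⟨e.symm hk, fun h' => hk' (e'.symm h'), h⟩

theorem gapLT.asymm (hδ : ∀ j, 0 ≤ δ j) {k l : ℕ} {a b : X} (hab : gapLT f δ k a b)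
    (hba : gapLT f δ l b a) : False := by
  have e := gapRel_equivalence (f := f) hδ
  have : k = l := gapRel_not_succ_unique hab.1 hab.2.1 ((e l).symm hba.1)
    fun h => hba.2.1 ((e _).symm h)
  subst this
  exact lt_asymm hab.2.2 hba.2.2

/-- If the number of pairwise inequivalent points is bounded, a largest set of such points is a
system of representatives. -/
theorem exists_representatives {r : X → X → Prop} (hr : Equivalence r) {K : ℕ}
    (hK : ∀ F : Finset X, (∀ a ∈ F, ∀ b ∈ F, a ≠ b → ¬ r a b) → F.card ≤ K) :
    ∃ F : Finset X, (∀ a ∈ F, ∀ b ∈ F, a ≠ b → ¬ r a b) ∧ ∀ a, ∃ p ∈ F, r p a := by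
  classical
  set S : Set ℕ := {k | ∃ F : Finset X, (∀ a ∈ F, ∀ b ∈ F, a ≠ b → ¬ r a b) ∧ F.card = k} with hS
  have hbdd : BddAbove S := ⟨K, by rintro _ ⟨F, hF, rfl⟩; exact hK F hF⟩
  obtain ⟨F, hF, hcard⟩ := Nat.sSup_mem (s := S) ⟨0, ∅, by simp, rfl⟩ hbdd
  refine ⟨F, hF, fun a => ?_⟩
  by_contra! h
  have haF : a ∉ F := fun ha => h a ha (hr.refl a)
  have hmem : (insert a F).card ∈ S := by
    refine ⟨insert a F, ?_, rfl⟩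
    intro x hx y hy hxy
    rcases Finset.mem_insert.1 hx with hxa | hx' <;> rcases Finset.mem_insert.1 hy with hya | hy'
    · exact absurd (hxa.trans hya.symm) hxy
    · rw [hxa]
      exact fun h' => h y hy' (hr.symm h')
    · rw [hya]
      exact h x hx'
    · exact hF x hx' y hy' hxy
  have := le_csSup hbdd hmem
  rw [Finset.card_insert_of_notMem haF] at this
  omega

open Classical in
/-- The classes at level `j` that lie strictly before the class of `a`, given by representatives
taken from a system of representatives `N j`. -/
noncomputable def precedingClasses (f : ℕ → X → ℝ) (δ : ℕ → ℝ) (N : ℕ → Finset X) (j : ℕ)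
    (a : X) : Finset X :=
  {p ∈ N j | ∃ k < j, gapLT f δ k p a}

variable {N : ℕ → Finset X}

theorem mem_precedingClasses {j : ℕ} {a p : X} :
    p ∈ precedingClasses f δ N j a ↔ p ∈ N j ∧ ∃ k < j, gapLT f δ k p a := by
  simp [precedingClasses]

theorem precedingClasses_subset_of_gapLT (hδ : ∀ j, 0 ≤ δ j) {k : ℕ} {a b : X}
    (hab : gapLT f δ k a b) (j : ℕ) :
    precedingClasses f δ N j a ⊆ precedingClasses f δ N j b := by
  intro p hp
  rw [mem_precedingClasses] at hp ⊢
  obtain ⟨hpN, l, hl, hpa⟩ := hp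
  exact ⟨hpN, min l k, (min_le_left _ _).trans_lt hl, hpa.trans hδ hab⟩

theorem precedingClasses_eq_of_gapLT (hδ : ∀ j, 0 ≤ δ j) {k : ℕ} {a b : X}
    (hab : gapLT f δ k a b) {j : ℕ} (hj : j ≤ k) :
    precedingClasses f δ N j a = precedingClasses f δ N j b := by
  refine (precedingClasses_subset_of_gapLT hδ hab j).antisymm fun p hp => ?_
  rw [mem_precedingClasses] at hp ⊢
  obtain ⟨hpN, l, hl, hpb⟩ := hp
  exact ⟨hpN, l, hl, hpb.congr_right hδ
    ((gapRel_equivalence hδ _).symm (gapRel_of_le (by omega) hab.1))⟩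

theorem card_precedingClasses_lt_of_gapLT (hδ : ∀ j, 0 ≤ δ j)
    (hN : ∀ j a, ∃ p ∈ N j, gapRel f δ j p a) {k : ℕ} {a b : X} (hab : gapLT f δ k a b) :
    (precedingClasses f δ N (k + 1) a).card < (precedingClasses f δ N (k + 1) b).card := by
  refine Finset.card_lt_card ((Finset.ssubset_iff_of_subset
    (precedingClasses_subset_of_gapLT hδ hab _)).2 ?_)
  obtain ⟨p, hpN, hpa⟩ := hN (k + 1) a
  refine ⟨p, mem_precedingClasses.2 ⟨hpN, k, k.lt_succ_self,
    hab.congr_left hδ ((gapRel_equivalence hδ _).symm hpa)⟩, fun hp => ?_⟩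
  obtain ⟨-, l, hl, h⟩ := mem_precedingClasses.1 hp
  exact h.2.1 (gapRel_of_le hl hpa)

/-- Classes are convex for the order: if `a < b` are in the same class at level `k`, the classes
counted for `b` and not for `a` are contained in it. -/
theorem gapRel_of_mem_precedingClasses_sdiff (hδ : ∀ j, 0 ≤ δ j) {k j : ℕ} {a b p : X}
    (hab : gapLT f δ k a b) (hkj : k < j) (hpb : p ∈ precedingClasses f δ N j b)
    (hpa : p ∉ precedingClasses f δ N j a) : gapRel f δ k p a := by
  by_contra hp
  obtain ⟨l, hl, h1, h2⟩ := exists_gapRel_not_succ hp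
  obtain ⟨hpN, l', hl', hpb'⟩ := mem_precedingClasses.1 hpb
  rcases gapLT_or_gapLT hδ h1 h2 with h | h
  · exact hpa (mem_precedingClasses.2 ⟨hpN, l, by omega, h⟩)
  · exact (h.congr_left hδ (gapRel_of_le (by omega : l + 1 ≤ k) hab.1)).asymm hδ hpb'

end GapOrder

/-! ### Coding a homogeneous set by the line -/

section Coding

variable {X : Type*} [PseudoMetricSpace X] {f : ℕ → X → ℝ} {δ : ℕ → ℝ}

/-- Points that are not cut apart by `f j` have values of `f j` at distance `O(δ j (D / δ j) ^ t)`,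
where `D` bounds the diameter of their class: one finds `δ j`-separated points of the class above
points spaced by `4 δ j` between the two values, and homogeneity bounds their number. -/
theorem abs_sub_le_of_gapRel_succ {C t D : ℝ} {j : ℕ} (hX : HomogeneousWith C t (univ : Set X))
    (hf : ∀ a b, |f j a - f j b| ≤ dist a b) (hδ : 0 < δ j) (hD : δ j ≤ D) {a b : X}
    (hdist : ∀ v, gapRel f δ j a v → dist v a ≤ D) (hab : gapRel f δ (j + 1) a b) :
    |f j a - f j b| ≤ 4 * δ j * (C * (D / δ j) ^ t) := by
  classical
  set e := |f j a - f j b| with he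
  set lo := min (f j a) (f j b) with hlo
  have hhi : max (f j a) (f j b) = lo + e := by
    have := max_sub_min_eq_abs (f j a) (f j b)
    rw [abs_sub_comm] at this
    linarith
  set K := ⌊e / (4 * δ j)⌋₊ + 1 with hK
  have hw : ∀ l < K, lo + 4 * δ j * l ∈ uIcc (f j a) (f j b) := by
    intro l hl
    have h1 : (l : ℝ) ≤ e / (4 * δ j) :=
      (Nat.cast_le.2 (by omega)).trans (Nat.floor_le (by positivity))
    rw [le_div_iff₀ (by linarith)] at h1
    refine ⟨?_, ?_⟩
    · change lo ≤ _
      have : 0 ≤ 4 * δ j * (l : ℝ) := by positivity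
      linarith
    · change _ ≤ max (f j a) (f j b)
      rw [hhi]
      linarith
  have hv : ∀ l : ℕ, ∃ v, l < K → gapRel f δ j a v ∧ |f j v - (lo + 4 * δ j * l)| ≤ δ j :=
    fun l => by
      by_cases hl : l < K
      · obtain ⟨v, hv⟩ := hab.2 _ (hw l hl)
        exact ⟨v, fun _ => hv⟩
      · exact ⟨a, fun h => absurd h hl⟩
  choose v hv using hv
  have hsep : ∀ l < K, ∀ l' < K, l ≠ l' → δ j ≤ dist (v l) (v l') := by
    intro l hl l' hl' hne
    refine le_trans ?_ (hf _ _)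
    have h1 := abs_le.1 (hv l hl).2
    have h2 := abs_le.1 (hv l' hl').2
    rcases lt_or_gt_of_ne hne with h | h
    · have : (l : ℝ) + 1 ≤ l' := by exact_mod_cast h
      have := mul_le_mul_of_nonneg_left this (by linarith : 0 ≤ 4 * δ j)
      rw [abs_sub_comm]
      exact le_trans (by linarith) (le_abs_self _)
    · have : (l' : ℝ) + 1 ≤ l := by exact_mod_cast h
      have := mul_le_mul_of_nonneg_left this (by linarith : 0 ≤ 4 * δ j)
      exact le_trans (by linarith) (le_abs_self _)
  have hinj : InjOn v (Finset.range K) := by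
    intro l hl l' hl' h
    by_contra hne
    have := hsep l (by simpa using hl) l' (by simpa using hl') hne
    rw [h, dist_self] at this
    linarith
  have hcard := hX a (mem_univ a) D (δ j) hδ hD ((Finset.range K).image v)
    (fun _ _ => mem_univ _) (fun y hy => by
      obtain ⟨l, hl, rfl⟩ := Finset.mem_image.1 hy
      exact hdist _ (hv l (Finset.mem_range.1 hl)).1) (fun y hy z hz hyz => by
      obtain ⟨l, hl, rfl⟩ := Finset.mem_image.1 hy
      obtain ⟨l', hl', rfl⟩ := Finset.mem_image.1 hz
      exact hsep l (Finset.mem_range.1 hl) l' (Finset.mem_range.1 hl') fun h => hyz (by rw [h]))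
  rw [Finset.card_image_of_injOn hinj, Finset.card_range] at hcard
  have h1 : e / (4 * δ j) ≤ K := by
    rw [hK]; push_cast; exact (Nat.lt_floor_add_one _).le
  rw [div_le_iff₀ (by linarith)] at h1
  calc e ≤ K * (4 * δ j) := h1
    _ ≤ (C * (D / δ j) ^ t) * (4 * δ j) := mul_le_mul_of_nonneg_right hcard (by linarith)
    _ = _ := mul_comm _ _

/-- For gaps `ρ 2 ^ (-j)`, with `ρ` small, the classes at level `j` have diameter at most `2 ^ (-j)`.
The hypothesis `hfK` says that any `n` consecutive functions `f i` control the distance; over `n`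
levels, cutting divides the diameter by at least `2 ^ n` because `ρ ^ (1 - t)` is small, and this is
where `t < 1` is needed. -/
theorem dist_le_of_gapRel {C t ρ K : ℝ} {n : ℕ} (hC : 0 ≤ C)
    (hX : HomogeneousWith C t (univ : Set X))
    (hf : ∀ j a b, |f j a - f j b| ≤ dist a b)
    (hfK : ∀ a b D j, 0 ≤ D → (∀ i, j ≤ i → i < j + n → |f i a - f i b| ≤ D) → dist a b ≤ K * D)
    (hdiam : ∀ a b : X, dist a b ≤ (1 / 2) ^ n) (hρ0 : 0 < ρ) (hρ1 : ρ ≤ 1)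
    (hρ : 4 * K * C * ρ ^ (1 - t) * 2 ^ n ≤ 1) (hδ : ∀ j, δ j = ρ * (1 / 2) ^ j) (j : ℕ) :
    ∀ a b : X, gapRel f δ j a b → dist a b ≤ (1 / 2) ^ j := by
  have hδ0 : ∀ j, 0 < δ j := fun j => by rw [hδ]; positivity
  have hsymm : ∀ j, Equivalence (gapRel f δ j) := gapRel_equivalence fun j => (hδ0 j).le
  induction j using Nat.strong_induction_on with
  | _ j ih =>
    intro a b hab
    rcases lt_or_ge j n with hjn | hjn
    · exact (hdiam a b).trans (pow_le_pow_of_le_one (by norm_num) (by norm_num) hjn.le)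
    have hD : 0 ≤ 4 * C * ρ ^ (1 - t) * 2 ^ n * (1 / 2) ^ j := by positivity
    refine (hfK a b _ (j - n) hD fun i hi1 hi2 => ?_).trans (?_ : K * _ ≤ _)
    · have hi : i < j := by omega
      have h1 := abs_sub_le_of_gapRel_succ (D := (1 / 2) ^ i) hX (hf i) (hδ0 i)
        (by rw [hδ]; exact mul_le_of_le_one_left (by positivity) hρ1)
        (fun v hv => ih i hi v a ((hsymm i).symm hv)) (gapRel_of_le hi hab)
      refine h1.trans ?_
      have h2 : ((1 / 2) ^ i / δ i : ℝ) = ρ⁻¹ := by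
        rw [hδ]; field_simp
      have h3 : ρ * ρ⁻¹ ^ t = ρ ^ (1 - t) := by
        rw [Real.inv_rpow hρ0.le, Real.rpow_sub hρ0, Real.rpow_one, div_eq_mul_inv]
      have h4 : ((1 / 2) ^ i : ℝ) ≤ 2 ^ n * (1 / 2) ^ j := by
        have h6 : ((1 / 2) ^ i : ℝ) = 2 ^ n * (1 / 2) ^ (i + n) := by
          rw [pow_add, one_div_pow, one_div_pow]; field_simp
        rw [h6]
        exact mul_le_mul_of_nonneg_left (pow_le_pow_of_le_one (by norm_num) (by norm_num)
          (by omega)) (by positivity)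
      rw [h2, hδ]
      calc 4 * (ρ * (1 / 2) ^ i) * (C * ρ⁻¹ ^ t) = 4 * C * (ρ * ρ⁻¹ ^ t) * (1 / 2) ^ i := by ring
        _ ≤ 4 * C * (ρ * ρ⁻¹ ^ t) * (2 ^ n * (1 / 2) ^ j) :=
          mul_le_mul_of_nonneg_left h4 (by positivity)
        _ = _ := by rw [h3]; ring
    · have := mul_le_mul_of_nonneg_right hρ (by positivity : (0 : ℝ) ≤ (1 / 2) ^ j)
      linarith

/-- The number of classes at level `k + i` in a class at level `k` is `O((2 ^ t) ^ i)`. -/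
theorem card_le_of_pairwise_not_gapRel {C t ρ : ℝ} (hX : HomogeneousWith C t (univ : Set X))
    (hf : ∀ j a b, |f j a - f j b| ≤ dist a b) (hρ0 : 0 < ρ) (hρ1 : ρ ≤ 1)
    (hδ : ∀ j, δ j = ρ * (1 / 2) ^ j)
    (hR : ∀ k (a b : X), gapRel f δ k a b → dist a b ≤ (1 / 2) ^ k) (k i : ℕ) (a : X)
    (F : Finset X) (hF : ∀ p ∈ F, gapRel f δ k p a)
    (hne : ∀ p ∈ F, ∀ q ∈ F, p ≠ q → ¬ gapRel f δ (k + i) p q) :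
    (F.card : ℝ) ≤ C / ρ ^ t * (2 ^ t) ^ i := by
  have hδ0 : ∀ j, 0 < δ j := fun j => by rw [hδ]; positivity
  have hanti : ∀ {j j'}, j ≤ j' → δ j' ≤ δ j := fun {j j'} h => by
    rw [hδ, hδ]
    exact mul_le_mul_of_nonneg_left (pow_le_pow_of_le_one (by norm_num) (by norm_num) h) hρ0.le
  have h := hX a (mem_univ a) ((1 / 2) ^ k) (δ (k + i)) (hδ0 _) ((hanti (Nat.le_add_right k i)).trans
    (by rw [hδ]; exact mul_le_of_le_one_left (by positivity) hρ1)) F (fun _ _ => mem_univ _)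
    (fun p hp => hR k p a (hF p hp)) (fun p hp q hq hpq => by
      obtain ⟨j, hj, h1, h2⟩ := exists_gapRel_not_succ (hne p hp q hq hpq)
      have h3 := two_mul_le_abs_of_gap (fun j => (hδ0 j).le) h1 h2
      linarith [hf j p q, hanti hj.le, hδ0 j])
  have h2 : ((1 / 2) ^ k / δ (k + i) : ℝ) = 2 ^ i / ρ := by
    rw [hδ, pow_add, one_div_pow, one_div_pow]; field_simp
  rw [h2, Real.div_rpow (by positivity) hρ0.le, ← Real.rpow_pow_comm (by norm_num)] at h
  refine h.trans (le_of_eq ?_)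
  ring

/-- A homogeneous set with `t < 1` embeds in `ℝ` bi-Lipschitz, in an order compatible with the
coordinates `f j`. The embedding is `h a = ∑ 2 ^ (-j) #{classes at level j before a}`. If `a < b` are
separated at level `k`, only the levels `j > k` contribute to `h b - h a`; level `k + 1`
contributes at least `2 ^ (-(k + 1))`, and level `k + i` at most a constant times
`2 ^ (-(k + i)) (2 ^ t) ^ i`, which is summable with sum `O(2 ^ (-k))`. -/
theorem exists_order_coding {X : Type*} [MetricSpace X] {f : ℕ → X → ℝ} {C t ρ K : ℝ} {n : ℕ} (ht : t < 1) (hC : 0 ≤ C)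
    (hX : HomogeneousWith C t (univ : Set X))
    (hf : ∀ j a b, |f j a - f j b| ≤ dist a b)
    (hfK : ∀ a b D j, 0 ≤ D → (∀ i, j ≤ i → i < j + n → |f i a - f i b| ≤ D) → dist a b ≤ K * D)
    (hdiam : ∀ a b : X, dist a b ≤ (1 / 2) ^ n) (hρ0 : 0 < ρ) (hρ1 : ρ ≤ 1)
    (hρ : 4 * K * C * ρ ^ (1 - t) * 2 ^ n ≤ 1) :
    ∃ (h : X → ℝ) (B : ℝ), 0 ≤ B ∧ (∀ a b, 1 / 2 * dist a b ≤ |h a - h b|) ∧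
      (∀ a b, |h a - h b| ≤ B * dist a b) ∧
      ∀ a b, h a < h b → ∃ j, f j a < f j b ∧ 2 * ρ * dist a b ≤ |f j a - f j b| := by
  obtain ⟨δ, hδ⟩ : ∃ δ : ℕ → ℝ, ∀ j, δ j = ρ * (1 / 2) ^ j := ⟨_, fun _ => rfl⟩
  have hδ0 : ∀ j, 0 ≤ δ j := fun j => by rw [hδ]; positivity
  have hR : ∀ k (a b : X), gapRel f δ k a b → dist a b ≤ (1 / 2) ^ k :=
    dist_le_of_gapRel hC hX hf hfK hdiam hρ0 hρ1 hρ hδ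
  have hcard := card_le_of_pairwise_not_gapRel hX hf hρ0 hρ1 hδ hR
  have e := gapRel_equivalence (f := f) hδ0
  have hN : ∀ j, ∃ F : Finset X, (∀ a ∈ F, ∀ b ∈ F, a ≠ b → ¬ gapRel f δ j a b) ∧
      ∀ a, ∃ p ∈ F, gapRel f δ j p a := by
    intro j
    refine exists_representatives (e j) (K := ⌊C / ρ ^ t * (2 ^ t) ^ j⌋₊) fun F hF => ?_
    rcases F.eq_empty_or_nonempty with rfl | ⟨a, -⟩
    · simp
    · refine Nat.le_floor (hcard 0 j a F (fun _ _ => trivial) ?_)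
      simpa using hF
  choose N hN hNcov using hN
  -- The ratio of the contributions of consecutive levels, less than `1` since `t < 1`.
  set θ : ℝ := 2 ^ t / 2 with hθ
  have hθ0 : 0 < θ := by positivity
  have hθ1 : θ < 1 := by
    rw [hθ, div_lt_one (by norm_num)]
    simpa using Real.rpow_lt_rpow_of_exponent_lt (by norm_num : (1 : ℝ) < 2) ht
  have hθpow : ∀ i : ℕ, (1 / 2 : ℝ) ^ i * (2 ^ t) ^ i = θ ^ i := fun i => by
    rw [hθ, ← mul_pow]; congr 1; ring
  set T : ℕ → X → ℝ := fun j a => (1 / 2) ^ j * ((precedingClasses f δ N j a).card : ℝ) with hT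
  have hsum : ∀ a, Summable fun j => T j a := by
    intro a
    refine Summable.of_nonneg_of_le (fun j => by positivity) (fun j => ?_)
      ((summable_geometric_of_lt_one hθ0.le hθ1).mul_left (C / ρ ^ t))
    have h1 := hcard 0 j a (precedingClasses f δ N j a) (fun _ _ => trivial) (by
      intro p hp q hq
      rw [zero_add]
      exact hN j p (mem_precedingClasses.1 hp).1 q (mem_precedingClasses.1 hq).1)
    calc T j a ≤ (1 / 2) ^ j * (C / ρ ^ t * (2 ^ t) ^ j) :=
          mul_le_mul_of_nonneg_left h1 (by positivity)
      _ = C / ρ ^ t * θ ^ j := by rw [← hθpow]; ring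
  set h : X → ℝ := fun a => ∑' j, T j a with hh
  set B₀ : ℝ := C / ρ ^ t / (1 - θ) with hB₀
  have hB₀0 : 0 ≤ B₀ := div_nonneg (by positivity) (by linarith)
  have key : ∀ k a b, gapLT f δ k a b →
      (1 / 2) ^ (k + 1) ≤ h b - h a ∧ h b - h a ≤ B₀ * (1 / 2) ^ k := by
    intro k a b hab
    have hdiff : h b - h a = ∑' j, (T j b - T j a) := ((hsum b).tsum_sub (hsum a)).symm
    have hs : Summable fun j => T j b - T j a := (hsum b).sub (hsum a)
    have hnonneg : ∀ j, 0 ≤ T j b - T j a := fun j => by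
      rw [sub_nonneg]
      refine mul_le_mul_of_nonneg_left ?_ (by positivity)
      exact_mod_cast Finset.card_le_card (precedingClasses_subset_of_gapLT hδ0 hab j)
    have hzero : ∀ j ≤ k, T j b - T j a = 0 := fun j hj => by
      simp only [hT, precedingClasses_eq_of_gapLT hδ0 hab hj, sub_self]
    constructor
    · rw [hdiff]
      refine le_trans ?_ (hs.le_tsum (k + 1) fun j _ => hnonneg j)
      have := card_precedingClasses_lt_of_gapLT hδ0 hNcov hab
      have : ((precedingClasses f δ N (k + 1) a).card : ℝ) + 1
          ≤ (precedingClasses f δ N (k + 1) b).card := by exact_mod_cast this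
      simp only [hT]
      rw [← mul_sub]
      exact le_mul_of_one_le_right (by positivity) (by linarith)
    · rw [hdiff, ← hs.sum_add_tsum_nat_add k, Finset.sum_eq_zero fun j hj =>
        hzero j (Finset.mem_range.1 hj).le, zero_add]
      have hg := ((hasSum_geometric_of_lt_one hθ0.le hθ1).mul_left
        ((1 / 2) ^ k * (C / ρ ^ t)))
      have hle : ∀ i, T (i + k) b - T (i + k) a ≤ (1 / 2) ^ k * (C / ρ ^ t) * θ ^ i := by
        classical
        intro i
        rcases Nat.eq_zero_or_pos i with rfl | hi
        · rw [zero_add, hzero k le_rfl]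
          positivity
        have hsub := precedingClasses_subset_of_gapLT (N := N) hδ0 hab (i + k)
        have h1 := hcard k i a (precedingClasses f δ N (i + k) b \ precedingClasses f δ N (i + k) a)
          (fun p hp => gapRel_of_mem_precedingClasses_sdiff hδ0 hab (by omega)
            (Finset.mem_sdiff.1 hp).1 (Finset.mem_sdiff.1 hp).2) (by
          intro p hp q hq
          rw [add_comm k i]
          exact hN _ p (mem_precedingClasses.1 (Finset.mem_sdiff.1 hp).1).1 q
            (mem_precedingClasses.1 (Finset.mem_sdiff.1 hq).1).1)
        rw [Finset.cast_card_sdiff hsub] at h1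
        simp only [hT]
        rw [← mul_sub]
        calc _ ≤ (1 / 2) ^ (i + k) * (C / ρ ^ t * (2 ^ t) ^ i) :=
              mul_le_mul_of_nonneg_left h1 (by positivity)
          _ = _ := by rw [← hθpow, pow_add]; ring
      refine (((summable_nat_add_iff k).2 hs).tsum_le_tsum hle hg.summable).trans (le_of_eq ?_)
      rw [hg.tsum_eq, hB₀]
      ring
  have hcmp : ∀ k a b, gapLT f δ k a b → 2 * ρ * (1 / 2) ^ k ≤ |f k a - f k b| := by
    intro k a b hab
    have := two_mul_le_abs_of_gap hδ0 hab.1 hab.2.1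
    rw [hδ] at this
    linarith
  have hsepex : ∀ a b : X, a ≠ b → ∃ k, gapLT f δ k a b ∨ gapLT f δ k b a := by
    intro a b hab
    have : ∃ j, ¬ gapRel f δ j a b := by
      by_contra! hall
      have h0 : dist a b ≤ 0 := ge_of_tendsto'
        (tendsto_pow_atTop_nhds_zero_of_lt_one (by norm_num) (by norm_num)) fun k => hR k a b (hall k)
      exact hab (dist_le_zero.1 h0)
    obtain ⟨j, hj⟩ := this
    obtain ⟨k, -, h1, h2⟩ := exists_gapRel_not_succ hj
    exact ⟨k, gapLT_or_gapLT hδ0 h1 h2⟩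
  have hlow : ∀ k a b, gapLT f δ k a b → 1 / 2 * dist a b ≤ |h a - h b| := by
    intro k a b hab
    rw [abs_sub_comm]
    refine le_trans ?_ (((key k a b hab).1).trans (le_abs_self _))
    rw [pow_succ]
    linarith [hR k a b hab.1]
  have hup : ∀ k a b, gapLT f δ k a b → |h a - h b| ≤ B₀ / (2 * ρ) * dist a b := by
    intro k a b hab
    obtain ⟨h1, h2⟩ := key k a b hab
    have h0 : (0 : ℝ) < (1 / 2) ^ (k + 1) := by positivity
    rw [abs_sub_comm, abs_of_nonneg (by linarith)]
    refine h2.trans ?_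
    rw [div_mul_eq_mul_div B₀, le_div_iff₀ (by linarith), mul_assoc]
    refine mul_le_mul_of_nonneg_left ?_ hB₀0
    linarith [hcmp k a b hab, hf k a b]
  refine ⟨h, B₀ / (2 * ρ), by positivity, fun a b => ?_, fun a b => ?_, fun a b hab => ?_⟩
  · rcases eq_or_ne a b with rfl | hab
    · simp
    · obtain ⟨k, hk | hk⟩ := hsepex a b hab
      · exact hlow k a b hk
      · rw [dist_comm, abs_sub_comm]
        exact hlow k b a hk
  · rcases eq_or_ne a b with rfl | hab
    · simp
    · obtain ⟨k, hk | hk⟩ := hsepex a b hab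
      · exact hup k a b hk
      · rw [dist_comm, abs_sub_comm]
        exact hup k b a hk
  · have hne : a ≠ b := fun heq => by rw [heq] at hab; exact lt_irrefl _ hab
    obtain ⟨k, hk | hk⟩ := hsepex a b hne
    · refine ⟨k, hk.2.2, le_trans ?_ (hcmp k a b hk)⟩
      exact mul_le_mul_of_nonneg_left (hR k a b hk.1) (by positivity)
    · have h1 := (key k b a hk).1
      have h0 : (0 : ℝ) < (1 / 2) ^ (k + 1) := by positivity
      linarith

end Coding

/-! ### Curves through a coded set -/

section OneSidedNorm

variable {n : ℕ}

/-- The `ℓ¹` norm in which the coordinate `e` counts only when it is positive. It is an asymmetric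
gauge that vanishes on the downward ray in the direction `e`. -/
noncomputable def oneSidedNorm (e : Fin n) (v : EuclideanSpace ℝ (Fin n)) : ℝ :=
  ∑ k, if k = e then max (v k) 0 else |v k|

variable (e : Fin n)

theorem oneSidedNorm_zero : oneSidedNorm e 0 = 0 := by
  simp [oneSidedNorm]

theorem oneSidedNorm_add_le (u v : EuclideanSpace ℝ (Fin n)) :
    oneSidedNorm e (u + v) ≤ oneSidedNorm e u + oneSidedNorm e v := by
  simp only [oneSidedNorm, ← Finset.sum_add_distrib]
  refine Finset.sum_le_sum fun k _ => ?_
  split_ifs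
  · exact max_le (add_le_add (le_max_left _ _) (le_max_left _ _))
      (add_nonneg (le_max_right _ _) (le_max_right _ _))
  · exact abs_add_le _ _

theorem oneSidedNorm_le (v : EuclideanSpace ℝ (Fin n)) : oneSidedNorm e v ≤ n * ‖v‖ := by
  have : ∀ k ∈ (Finset.univ : Finset (Fin n)), (if k = e then max (v k) 0 else |v k|) ≤ ‖v‖ := by
    intro k _
    have h := EuclideanSpace.abs_apply_le_norm v k
    split_ifs
    · exact max_le ((le_abs_self _).trans h) (norm_nonneg _)
    · exact h
  simpa [oneSidedNorm] using Finset.sum_le_sum this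

theorem oneSidedNorm_neg_smul_single {τ : ℝ} (hτ : 0 ≤ τ) :
    oneSidedNorm e (-(τ • EuclideanSpace.single e (1 : ℝ))) = 0 := by
  refine Finset.sum_eq_zero fun k _ => ?_
  by_cases hk : k = e
  · simp [hk, hτ]
  · simp [hk]

theorem norm_le_oneSidedNorm {v : EuclideanSpace ℝ (Fin n)} (hv : 0 ≤ v e) :
    ‖v‖ ≤ oneSidedNorm e v := by
  refine (EuclideanSpace.norm_le_sum_abs v).trans (Finset.sum_le_sum fun k _ => ?_)
  split_ifs with h
  · rw [h, abs_of_nonneg hv]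
    exact le_max_left _ _
  · exact le_rfl

theorem abs_apply_le_oneSidedNorm {k : Fin n} (hk : k ≠ e) (v : EuclideanSpace ℝ (Fin n)) :
    |v k| ≤ oneSidedNorm e v := by
  have := Finset.single_le_sum (f := fun k => if k = e then max (v k) 0 else |v k|)
    (fun k _ => by split_ifs <;> positivity) (Finset.mem_univ k)
  simpa [hk, oneSidedNorm] using this

theorem oneSidedNorm_nonneg (v : EuclideanSpace ℝ (Fin n)) : 0 ≤ oneSidedNorm e v :=
  Finset.sum_nonneg fun k _ => by split_ifs <;> positivity

end OneSidedNorm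

/-- A bi-Lipschitz function `h` on a family of points extends to a Lipschitz function on `ℝⁿ` that
increases with slope at least `c` in the direction `e`, provided that `h` increases with the
coordinate `e` on pairs of points that are nearly aligned in this direction, which is what `hord`
says. The extension is that of `h - c x_e` for the asymmetric gauge, plus `c x_e`. -/
theorem exists_lipschitz_extension_increasing {n : ℕ} {ι : Type*} [Nonempty ι] (e : Fin n)
    {a : ι → EuclideanSpace ℝ (Fin n)} {h : ι → ℝ} {c B κ : ℝ} (hc : 0 < c) (hB : 0 ≤ B)
    (hκ : 0 < κ) (hκ1 : κ ≤ 1) (hlow : ∀ i j, c * dist (a i) (a j) ≤ |h i - h j|)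
    (hup : ∀ i j, |h i - h j| ≤ B * dist (a i) (a j))
    (hord : ∀ i j, h i < h j → a i e < a j e ∨
      ∃ k ≠ e, κ * dist (a i) (a j) ≤ |a i k - a j k|) :
    ∃ (G : EuclideanSpace ℝ (Fin n) → ℝ) (L : ℝ), 0 < L ∧ (∀ i, G (a i) = h i) ∧
      (∀ x y, |G x - G y| ≤ L * dist x y) ∧
      ∀ x τ, 0 ≤ τ → c * τ ≤ G (x + τ • EuclideanSpace.single e (1 : ℝ)) - G x := by
  set K := (B + c) / κ with hK
  have hK0 : 0 ≤ K := by positivity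
  have hBK : B ≤ K := by
    rw [hK, le_div_iff₀ hκ]
    nlinarith
  have hKκ : K * κ = B + c := div_mul_cancel₀ _ hκ.ne'
  obtain ⟨G₀, hG₀, hG₀q⟩ := exists_extension_of_subadditive (fun v => K * oneSidedNorm e v)
    (by simp [oneSidedNorm_zero])
    (fun u v => by
      rw [← mul_add]; exact mul_le_mul_of_nonneg_left (oneSidedNorm_add_le e u v) hK0)
    a (fun i => h i - c * a i e) (fun i j => by
      set v := a i - a j with hv
      have hdist : dist (a i) (a j) = ‖v‖ := dist_eq_norm _ _
      have hve : v e = a i e - a j e := rfl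
      have hve' := abs_le.1 (EuclideanSpace.abs_apply_le_norm v e)
      have hu := (le_abs_self _).trans (hup i j)
      have hl := hlow i j
      rw [hdist] at hu hl
      have hgoal : h i - c * a i e - (h j - c * a j e) = (h i - h j) - c * v e := by
        rw [hve]; ring
      rw [hgoal]
      rcases le_or_gt 0 (v e) with h0 | h0
      · have h1 := mul_le_mul_of_nonneg_left (norm_le_oneSidedNorm e h0) hK0
        have h2 := mul_le_mul_of_nonneg_right hBK (norm_nonneg v)
        have h3 := mul_nonneg hc.le h0
        linarith
      · have hq0 := mul_nonneg hK0 (oneSidedNorm_nonneg e v)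
        have h4 : -(c * ‖v‖) ≤ c * v e := by
          rw [← mul_neg]; exact mul_le_mul_of_nonneg_left hve'.1 hc.le
        rcases lt_or_ge (h j) (h i) with hij | hij
        · rcases hord j i hij with h5 | ⟨k, hk, h5⟩
          · linarith
          · rw [dist_comm, hdist, abs_sub_comm] at h5
            have h6 : κ * ‖v‖ ≤ oneSidedNorm e v := h5.trans (abs_apply_le_oneSidedNorm e hk v)
            have h7 := mul_le_mul_of_nonneg_left h6 hK0
            rw [← mul_assoc, hKκ, add_mul] at h7
            linarith
        · rw [abs_of_nonpos (by linarith)] at hl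
          linarith)
  have hse : (EuclideanSpace.single e (1 : ℝ)) e = 1 := by simp
  refine ⟨fun x => c * x e + G₀ x, c + K * n, by positivity, fun i => by simp [hG₀ i],
    fun x y => ?_, fun x τ hτ => ?_⟩
  · have key : ∀ x y : EuclideanSpace ℝ (Fin n),
        (c * x e + G₀ x) - (c * y e + G₀ y) ≤ (c + K * n) * dist x y := by
      intro x y
      have h1 := hG₀q x y
      have h2 := mul_le_mul_of_nonneg_left (oneSidedNorm_le e (x - y)) hK0
      have h3 := mul_le_mul_of_nonneg_left
        ((le_abs_self _).trans (EuclideanSpace.abs_apply_le_norm (x - y) e)) hc.le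
      rw [PiLp.sub_apply] at h3
      rw [dist_eq_norm]
      linarith
    rw [abs_sub_le_iff]
    refine ⟨key x y, ?_⟩
    rw [dist_comm]
    exact key y x
  · have h1 := hG₀q x (x + τ • EuclideanSpace.single e (1 : ℝ))
    rw [sub_add_cancel_left, oneSidedNorm_neg_smul_single e hτ, mul_zero] at h1
    have h2 : (x + τ • EuclideanSpace.single e (1 : ℝ)) e = x e + τ := by simp
    simp only [h2]
    linarith

/-- Let `G` extend the coding `h` and increase in the direction `e`, and let `ψ` be a Lipschitz
extension of its inverse. Moving `ψ u` in the direction `e` to the point `f u` with `G (f u) = u`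
gives a curve which is bi-Lipschitz: `G` is a Lipschitz left inverse of it, and the lower bound on
the slope of `G` makes the displacement a Lipschitz function of `u`. On the values of
`h` the point `ψ u` is not moved, so the curve passes through the given points. -/
theorem exists_isBiLipschitzCurve_of_coding {n : ℕ} {ι : Type*} [Nonempty ι] (e : Fin n)
    {a : ι → EuclideanSpace ℝ (Fin n)} {h : ι → ℝ} {c B κ H : ℝ} (hc : 0 < c) (hB : 0 ≤ B)
    (hκ : 0 < κ) (hκ1 : κ ≤ 1) (hlow : ∀ i j, c * dist (a i) (a j) ≤ |h i - h j|)
    (hup : ∀ i j, |h i - h j| ≤ B * dist (a i) (a j))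
    (hord : ∀ i j, h i < h j → a i e < a j e ∨
      ∃ k ≠ e, κ * dist (a i) (a j) ≤ |a i k - a j k|)
    (hH : ∀ i j, |h i - h j| ≤ H) :
    ∃ Γ, IsBiLipschitzCurve Γ ∧ ∀ i, a i ∈ Γ := by
  obtain ⟨G, L, hL, hGa, hGL, hGc⟩ :=
    exists_lipschitz_extension_increasing e hc hB hκ hκ1 hlow hup hord
  obtain ⟨ψ, hψa, hψ⟩ := exists_holderOnWith_extension (p := h) (a := a) (K := c⁻¹) (α := 1)
    (by positivity) one_pos le_rfl (fun i j => by
      rw [Real.rpow_one, Real.dist_eq, inv_mul_eq_div, le_div_iff₀' hc]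
      exact hlow i j)
  set P : ℝ := n * c⁻¹ with hP
  have hP0 : 0 ≤ P := by positivity
  simp only [Real.rpow_one, Real.dist_eq] at hψ
  set v : EuclideanSpace ℝ (Fin n) := EuclideanSpace.single e (1 : ℝ) with hv
  have hv1 : ‖v‖ = 1 := by simp [hv]
  have hslope : ∀ x τ τ', τ ≤ τ' → c * (τ' - τ) ≤ G (x + τ' • v) - G (x + τ • v) := by
    intro x τ τ' hττ
    have := hGc (x + τ • v) (τ' - τ) (sub_nonneg.2 hττ)
    rwa [add_assoc, ← add_smul, add_sub_cancel] at this
  have hslope' : ∀ x τ τ', c * |τ' - τ| ≤ |G (x + τ' • v) - G (x + τ • v)| := by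
    intro x τ τ'
    rcases le_total τ τ' with hle | hle
    · rw [abs_of_nonneg (sub_nonneg.2 hle)]
      exact (hslope x τ τ' hle).trans (le_abs_self _)
    · rw [abs_sub_comm, abs_of_nonneg (sub_nonneg.2 hle), abs_sub_comm]
      exact (hslope x τ' τ hle).trans (le_abs_self _)
  have hGcont : Continuous G :=
    (LipschitzWith.of_dist_le_mul (K := ⟨L, hL.le⟩) fun x y => hGL x y).continuous
  have hζ : ∀ u : ℝ, ∃ τ : ℝ, G (ψ u + τ • v) = u := by
    intro u
    have hcont : Continuous fun τ : ℝ => G (ψ u + τ • v) := by fun_prop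
    refine hcont.surjective ?_ ?_ u
    · refine tendsto_atTop_mono' atTop ?_
        (tendsto_atTop_add_const_right atTop (G (ψ u)) (tendsto_id.const_mul_atTop hc))
      filter_upwards [eventually_ge_atTop 0] with τ hτ
      have := hslope (ψ u) 0 τ hτ
      simp only [zero_smul, add_zero, sub_zero] at this
      simp only [id]
      linarith
    · refine tendsto_atBot_mono' atBot ?_
        (tendsto_atBot_add_const_right atBot (G (ψ u)) (tendsto_id.const_mul_atBot hc))
      filter_upwards [eventually_le_atBot 0] with τ hτ
      have := hslope (ψ u) τ 0 hτ
      simp only [zero_smul, add_zero, zero_sub] at this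
      simp only [id]
      linarith
  choose ζ hζ using hζ
  set f : ℝ → EuclideanSpace ℝ (Fin n) := fun u => ψ u + ζ u • v with hf
  have hfa : ∀ i, f (h i) = a i := by
    intro i
    have h1 := hslope' (ψ (h i)) 0 (ζ (h i))
    rw [hζ, zero_smul, add_zero, hψa, hGa, sub_self, abs_zero, sub_zero] at h1
    have h2 : ζ (h i) = 0 := abs_eq_zero.1 (le_antisymm
      (nonpos_of_mul_nonpos_right h1 hc) (abs_nonneg _))
    simp [hf, h2, hψa]
  have hflow : ∀ u w, |u - w| ≤ L * ‖f u - f w‖ := by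
    intro u w
    have := hGL (f u) (f w)
    rwa [hζ, hζ, dist_eq_norm] at this
  set U := P + (L * P + 1) / c with hU
  have hfup : ∀ u w, ‖f u - f w‖ ≤ U * |u - w| := by
    intro u w
    have h1 : c * |ζ u - ζ w| ≤ (L * P + 1) * |u - w| := by
      have h2 := hslope' (ψ w) (ζ w) (ζ u)
      rw [hζ w] at h2
      have h3 := hGL (ψ w + ζ u • v) (ψ u + ζ u • v)
      rw [hζ u, dist_add_right] at h3
      have h4 := mul_le_mul_of_nonneg_left (hψ w u) hL.le
      rw [abs_sub_comm w u] at h4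
      have h5 := abs_sub_le (G (ψ w + ζ u • v)) u w
      linarith
    have h2 : |ζ u - ζ w| ≤ (L * P + 1) / c * |u - w| := by
      rw [div_mul_eq_mul_div, le_div_iff₀' hc]
      exact h1
    have h3 : f u - f w = (ψ u - ψ w) + (ζ u - ζ w) • v := by
      simp only [hf, sub_smul]; abel
    rw [h3]
    refine (norm_add_le _ _).trans ?_
    rw [norm_smul, hv1, mul_one, Real.norm_eq_abs, ← dist_eq_norm]
    have h4 := hψ u w
    rw [hU, add_mul]
    linarith
  obtain ⟨i₀⟩ := ‹Nonempty ι›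
  have hH0 : 0 ≤ H := (abs_nonneg _).trans (hH i₀ i₀)
  set R : ℝ := 2 * (H + 1) with hR
  have hR0 : 0 < R := by positivity
  set lo : ℝ := h i₀ - (H + 1) with hlo
  set M : ℝ := max 1 (max (L / R) (U * R)) with hM
  have hM1 : 1 ≤ M := le_max_left _ _
  have hML : L / R ≤ M := (le_max_left _ _).trans (le_max_right _ _)
  have hMU : U * R ≤ M := (le_max_right _ _).trans (le_max_right _ _)
  refine ⟨(fun x => f (lo + R * x)) '' Icc 0 1, ⟨fun x => f (lo + R * x), M, hM1, ?_, rfl⟩, ?_⟩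
  · intro x _ y _
    have h1 := hflow (lo + R * x) (lo + R * y)
    have h2 := hfup (lo + R * x) (lo + R * y)
    rw [add_sub_add_left_eq_sub, ← mul_sub, abs_mul, abs_of_pos hR0] at h1 h2
    constructor
    · rw [inv_mul_le_iff₀ (by linarith)]
      refine le_trans ?_ (mul_le_mul_of_nonneg_right hML (norm_nonneg _))
      rw [div_mul_eq_mul_div, le_div_iff₀' hR0]
      exact h1
    · rw [← mul_assoc] at h2
      exact h2.trans (mul_le_mul_of_nonneg_right hMU (abs_nonneg _))
  · intro i
    have h1 := abs_le.1 (hH i i₀)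
    refine ⟨(h i - lo) / R, ⟨by rw [le_div_iff₀ hR0]; linarith, by
      rw [div_le_iff₀ hR0]; linarith⟩, ?_⟩
    dsimp only
    rw [mul_div_cancel₀ _ hR0.ne', add_sub_cancel, hfa]

theorem HomogeneousWith.univ_subtype {X : Type*} [PseudoMetricSpace X] {C t : ℝ} {A : Set X}
    (hA : HomogeneousWith C t A) : HomogeneousWith C t (univ : Set A) := by
  intro x _ r δ hδ hδr F _ hFr hFδ
  rw [← Finset.card_map (Function.Embedding.subtype (· ∈ A))]
  refine hA x x.2 r δ hδ hδr _ ?_ ?_ ?_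
  · intro y hy
    obtain ⟨z, -, rfl⟩ := Finset.mem_map.1 hy
    exact z.2
  · intro y hy
    obtain ⟨z, hz, rfl⟩ := Finset.mem_map.1 hy
    exact hFr z hz
  · intro y hy y' hy' hne
    obtain ⟨z, hz, rfl⟩ := Finset.mem_map.1 hy
    obtain ⟨z', hz', rfl⟩ := Finset.mem_map.1 hy'
    exact hFδ z hz z' hz' fun h => hne (by rw [h])

theorem HomogeneousWith.exists_isBiLipschitzCurve {n : ℕ} (hn : n ≠ 0) {C t : ℝ} (ht : t < 1)
    {A : Set (EuclideanSpace ℝ (Fin n))} (hne : A.Nonempty) (hA : HomogeneousWith C t A)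
    (hdiam : ∀ x ∈ A, ∀ y ∈ A, dist x y ≤ (1 / 2) ^ n) :
    ∃ Γ, IsBiLipschitzCurve Γ ∧ A ⊆ Γ := by
  have : Nonempty A := hne.to_subtype
  have hC : 0 ≤ C := by
    obtain ⟨x, hx⟩ := hne
    simpa using hA x hx 1 1 one_pos le_rfl ∅ (by simp) (by simp) (by simp)
  have hmod : ∀ j, j % n < n := fun j => Nat.mod_lt _ (Nat.pos_of_ne_zero hn)
  set M : ℝ := 4 * √n * C * 2 ^ n with hM
  have hM0 : 0 ≤ M := by positivity
  -- Chosen so that `ρ ^ (1 - t) = (M + 1)⁻¹`.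
  set ρ : ℝ := (M + 1) ^ (-(1 - t)⁻¹) with hρ
  have hρ0 : 0 < ρ := by positivity
  have hρ1 : ρ ≤ 1 := Real.rpow_le_one_of_one_le_of_nonpos (by linarith)
    (neg_nonpos.2 (inv_nonneg.2 (by linarith)))
  have hρM : 4 * √n * C * ρ ^ (1 - t) * 2 ^ n ≤ 1 := by
    have h1 : ρ ^ (1 - t) = (M + 1)⁻¹ := by
      rw [hρ, ← Real.rpow_mul (by positivity), neg_mul, inv_mul_cancel₀ (by linarith),
        Real.rpow_neg_one]
    have h2 : 4 * √n * C * ρ ^ (1 - t) * 2 ^ n = M / (M + 1) := by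
      rw [h1, hM]; ring
    rw [h2, div_le_one (by linarith)]
    linarith
  obtain ⟨h, B, hB, hlow, hup, hord⟩ := exists_order_coding (X := A) (n := n) (K := √n) (ρ := ρ)
    (f := fun j x => (x : EuclideanSpace ℝ (Fin n)) ⟨j % n, hmod j⟩) ht hC hA.univ_subtype
    (fun j a b => by
      rw [Subtype.dist_eq, dist_eq_norm]
      exact EuclideanSpace.abs_apply_le_norm (a.1 - b.1) _)
    (fun a b D j hD hw => by
      refine EuclideanSpace.dist_le_sqrt_mul hD fun i => ?_
      -- Every residue modulo `n` occurs among `n` consecutive indices.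
      obtain ⟨i', hi1, hi2, hi3⟩ : ∃ i', j ≤ i' ∧ i' < j + n ∧ i' % n = i := by
        have hi := i.2
        have hj := hmod j
        have hdm := Nat.div_add_mod j n
        by_cases hle : j % n ≤ i
        · exact ⟨n * (j / n) + i, by omega, by omega, by
            rw [Nat.mul_add_mod, Nat.mod_eq_of_lt hi]⟩
        · exact ⟨n * (j / n + 1) + i, by rw [mul_add]; omega, by rw [mul_add]; omega, by
            rw [Nat.mul_add_mod, Nat.mod_eq_of_lt hi]⟩
      have h1 := hw i' hi1 hi2
      have h2 : (⟨i' % n, hmod i'⟩ : Fin n) = i := Fin.ext hi3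
      rwa [h2] at h1)
    (fun a b => hdiam a a.2 b b.2) hρ0 hρ1 hρM
  set e : Fin n := ⟨0, Nat.pos_of_ne_zero hn⟩ with he
  obtain ⟨Γ, hΓ, hAΓ⟩ := exists_isBiLipschitzCurve_of_coding e (a := fun x : A => x.1) (h := h)
    (c := 1 / 2) (B := B) (κ := ρ) (H := B) (by norm_num) hB hρ0 hρ1 hlow hup (by
      intro i j hij
      obtain ⟨k, hk1, hk2⟩ := hord i j hij
      by_cases hke : (⟨k % n, hmod k⟩ : Fin n) = e
      · left
        rw [hke] at hk1
        exact hk1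
      · refine Or.inr ⟨_, hke, le_trans ?_ hk2⟩
        refine mul_le_mul_of_nonneg_right ?_ dist_nonneg
        linarith)
    (fun i j => (hup i j).trans (mul_le_of_le_one_right hB ((hdiam i i.2 j j.2).trans
      (pow_le_one₀ (by norm_num) (by norm_num)))))
  exact ⟨Γ, hΓ, fun x hx => hAΓ ⟨x, hx⟩⟩

/-! ### Rectifiability -/

theorem homogeneousWith_singleton {X : Type*} [PseudoMetricSpace X] {t : ℝ} (ht : 0 ≤ t) (x : X) :
    HomogeneousWith 1 t {x} := by
  intro y _ r δ hδ hδr F hF _ _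
  have h1 : F.card ≤ 1 := Finset.card_le_one.2 fun a ha b hb => (hF a ha).trans (hF b hb).symm
  rw [one_mul]
  exact (Nat.cast_le_one.2 h1).trans (Real.one_le_rpow ((one_le_div hδ).2 hδr) ht)

theorem theoremt (m n : ℕ) (hm : 1 ≤ m) (hmn : m < n)
    (s : ℝ) (hms : (m : ℝ) ≤ s) (hsn : s ≤ (n : ℝ))
    (t : ℝ) (ht : 0 ≤ t) (hts : t < s)
    (E : Set (EuclideanSpace ℝ (Fin n))) (hE : IsTSet t E)
    (hdens : ∀ᵐ x ∂(MeasureTheory.Measure.hausdorffMeasure t :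
        MeasureTheory.Measure (EuclideanSpace ℝ (Fin n))), x ∈ E → 0 < lowerDensity t E x) :
    CountablyHolderRectifiable t m s E ∧
      (t < 1 → CountablyBiLipschitzRectifiable t E) := by
  have hn : n ≠ 0 := by omega
  obtain ⟨A, C, hA, hdiam, hnull⟩ := exists_homogeneous_decomposition ht hE.2.2 hdens
    (ε := (1 / 2) ^ n) (by positivity)
  constructor
  · choose Γ hΓ hAΓ using fun i => (hA i).exists_isHolderCube hm hn hms hts fun x hx y hy =>
      (hdiam i x hx y hy).trans (pow_le_one₀ (by norm_num) (by norm_num))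
    exact ⟨Γ, hΓ, measure_mono_null (sdiff_subset_sdiff_right (iUnion_mono hAΓ)) hnull⟩
  · intro ht1
    -- The empty set is not coded, but the statement requires a curve for each index.
    have hcurve : ∀ i, ∃ Γ, IsBiLipschitzCurve Γ ∧ A i ⊆ Γ := by
      intro i
      rcases (A i).eq_empty_or_nonempty with h | h
      · obtain ⟨Γ, hΓ, -⟩ := (homogeneousWith_singleton ht
          (0 : EuclideanSpace ℝ (Fin n))).exists_isBiLipschitzCurve hn ht1 (singleton_nonempty _)
          (by rintro x rfl y rfl; simp)
        exact ⟨Γ, hΓ, h ▸ empty_subset _⟩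
      · exact (hA i).exists_isBiLipschitzCurve hn ht1 h (hdiam i)
    choose Γ hΓ hAΓ using hcurve
    exact ⟨Γ, hΓ, measure_mono_null (sdiff_subset_sdiff_right (iUnion_mono hAΓ)) hnull⟩
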